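/- **Principle of nil causality.** Let $n\ge 2$, $m\ge 0$, and consider on $\mathbb R^n$ the stochastic system $$d\mathbf x=\mathbf F(\mathbf x,s)\,ds+\mathbf B(\mathbf x,s)\,d\mathbf w ,\qquad(\ast)$$ where $\mathbf w$ is an $m$-dimensional standard Wiener process, $\mathbf F=(F_1,\dots,F_n)$ is continuously differentiable and $\mathbf B=(b_{ik})$ is an $n\times m$ matrix of twice continuously differentiable functions of $(\mathbf x,s)$. Solutions are understood in the weak sense (martingale problem). Suppose that $\mathbf x$ solves $(\ast)$ on a time interval $[t_0,t_1]$ and that $\mathbf x(s)$ has a probability density $\rho(\cdot,s)$ which is compactly supported (uniformly in $s\in[t_0,t_1]$) and twice continuously differentiable in $(\mathbf x,s)$. Write $\mathbf x_{\rm o}=(x_2,\dots,x_n)$, $\rho_{\rm o}=\int_{\mathbb R}\rho\,dx_1$ for the joint density of $\mathbf x_{\rm o}$, and $$H_{\rm o}(s)=-\int_{\mathbb R^{n-1}}\rho_{\rm o}\log\rho_{\rm o}\,d\mathbf x_{\rm o}.$$ Let $t_0<t<t_1$. The *modified system* on an interval $[t,t_2]$, $t_2>t$, is obtained by removing the first equation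 of $(\ast)$ and freezing $x_1$ as a parameter. Let $r(a;\cdot,s)$ be the density at time $s$ of the modified system with parameter $x_1=a$ started at time $t$ from the density $\rho_{\rm o}(\cdot,t)$, and let $q(\cdot,s)$ be the joint density of $(x_1(t),\tilde{\mathbf x}(s))$, where $\tilde{\mathbf x}$ follows the modified system with parameter $x_1(t)$ started from $\tilde{\mathbf x}(t)=\mathbf x_{\rm o}(t)$ (so $q(\cdot,t)=\rho(\cdot,t)$); these densities, too, are assumed to exist, to be compactly supported uniformly in $s\in[t,t_2]$ and to be twice continuously differentiable in space and time. The entropy of $\mathbf x_{\rm o}$ with the effect of $x_1$ excluded is $$H_{\rm o\setminus 1}(s)=-E\big[\log r(x_1(t);\tilde{\mathbf x}(s),s)\big]=-\int_{\mathbb R^n} q(x_1,\mathbf y,s)\,\log r(x_1;\mathbf y,s)\,dx_1\,d\mathbf y ,$$ and the information flow from $x_1$ to $(x_2,\dots,x_n)$ at time $t$ is $$T_{1\to{\rm o}}=\frac{dH_{\rm o}}{ds}\Big|_{s=t}-\frac{dH_{\rm o\setminus1}}{ds}\Big|_{s=t^+}.$$ If $F_2,\dots,F_n$ and the rows $2,\dots,n$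 of $\mathbf B$ do not depend on $x_1$, then both entropies are given by convergent integrals for $s$ near $t$ ($s\ge t$ for $H_{\rm o\setminus 1}$), both derivatives exist, and $$T_{1\to{\rm o}}=0 .$$ -/

import Mathlib

open MeasureTheory ProbabilityTheory Set Filter Topology

universe u

noncomputable section

/-- The partial derivative `∂φ/∂xᵢ` on `ℝᵏ`. -/
def partialD {k : ℕ} (i : Fin k) (φ : (Fin k → ℝ) → ℝ) (x : Fin k → ℝ) : ℝ :=
  fderiv ℝ φ x (Pi.single i 1)

/-- The generator at time `s` of the stochastic system `dx = F(x,s) ds + B(x,s) dw` on `ℝᵏ`,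
`w` an `m`-dimensional standard Wiener process:
`L_s φ = ∑ᵢ Fᵢ ∂ᵢφ + ½ ∑ᵢ ∑ⱼ gᵢⱼ ∂ᵢ∂ⱼφ` with `gᵢⱼ = ∑ₗ bᵢₗ bⱼₗ`. -/
def generator {k m : ℕ} (F : ℝ → (Fin k → ℝ) → (Fin k → ℝ))
    (B : ℝ → (Fin k → ℝ) → Matrix (Fin k) (Fin m) ℝ)
    (s : ℝ) (φ : (Fin k → ℝ) → ℝ) (x : Fin k → ℝ) : ℝ :=
  (∑ i, F s x i * partialD i φ x) +
    (1 / 2) * ∑ i, ∑ j, (∑ l, B s x i l * B s x j l) * partialD i (partialD j φ) x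

/-- `X` is a (weak) solution on the time interval `[s₀, s₁]` of the stochastic system
`dx = F(x,s) ds + B(x,s) dw`, in the sense of the martingale problem: it is a continuous process,
adapted to some filtration, and `φ(X_s) - ∫_{s₀}^s (L_τ φ)(X_τ) dτ` is a martingale for every
smooth compactly supported `φ`. -/
def IsSolution {k m : ℕ} {Ω : Type u} [MeasurableSpace Ω] (P : Measure Ω)
    (F : ℝ → (Fin k → ℝ) → (Fin k → ℝ))
    (B : ℝ → (Fin k → ℝ) → Matrix (Fin k) (Fin m) ℝ)
    (s₀ s₁ : ℝ) (X : ℝ → Ω → (Fin k → ℝ)) : Prop :=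
  (∀ o, ContinuousOn (fun s => X s o) (Icc s₀ s₁)) ∧
  ∃ 𝓕 : Filtration (Icc s₀ s₁) (inferInstance : MeasurableSpace Ω),
    (∀ s : Icc s₀ s₁, Measurable[𝓕 s] (X s)) ∧
    ∀ φ : (Fin k → ℝ) → ℝ, ContDiff ℝ (⊤ : ℕ∞) φ → HasCompactSupport φ →
      Martingale
        (fun (s : Icc s₀ s₁) (o : Ω) =>
          φ (X s o) - ∫ τ in s₀..(s : ℝ), generator F B τ φ (X τ o)) 𝓕 P

/-- `p s` is, for every `s ∈ [s₀, s₁]`, the probability density function of the state at time `s`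
of a solution on `[s₀, s₁]` of the stochastic system with drift `F` and noise amplitude `B`; and
this density is compactly supported (uniformly in `s ∈ [s₀, s₁]`) and twice continuously
differentiable in time and space. -/
def IsCompactPdf {k m : ℕ} (F : ℝ → (Fin k → ℝ) → (Fin k → ℝ))
    (B : ℝ → (Fin k → ℝ) → Matrix (Fin k) (Fin m) ℝ)
    (s₀ s₁ : ℝ) (p : ℝ → (Fin k → ℝ) → ℝ) : Prop :=
  (∃ (Ω : Type u) (_ : MeasurableSpace Ω) (P : Measure Ω) (_ : IsProbabilityMeasure P)
      (X : ℝ → Ω → (Fin k → ℝ)),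
    IsSolution P F B s₀ s₁ X ∧
    ∀ s ∈ Icc s₀ s₁, P.map (X s) = volume.withDensity (fun x => ENNReal.ofReal (p s x))) ∧
  (∀ s ∈ Icc s₀ s₁, ∀ x, 0 ≤ p s x) ∧
  (∃ K : Set (Fin k → ℝ), IsCompact K ∧ ∀ s ∈ Icc s₀ s₁, ∀ x, x ∉ K → p s x = 0) ∧
  ContDiffOn ℝ 2 (fun z : ℝ × (Fin k → ℝ) => p z.1 z.2) (Icc s₀ s₁ ×ˢ univ)

/-- The joint density of all components but the first one: the first variable (which has
index `0`) of `f` is integrated out. -/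
def marginalOthers {d : ℕ} (f : (Fin (d + 1) → ℝ) → ℝ) (y : Fin d → ℝ) : ℝ :=
  ∫ a : ℝ, f (Matrix.vecCons a y)

/-- The entropy of the components other than the first one at time `s`, where `ρ` is the density
of the whole state: `H(s) = - ∫ ρ_others log ρ_others`. -/
def entropyOthers {d : ℕ} (ρ : ℝ → (Fin (d + 1) → ℝ) → ℝ) (s : ℝ) : ℝ :=
  - ∫ y : Fin d → ℝ, marginalOthers (ρ s) y * Real.log (marginalOthers (ρ s) y)

/-- Drift of the system in which the first component is frozen (its equation becomes
`dx₁ = 0`), seen as a system for the whole state. -/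
def frozenDrift {d : ℕ} (F : ℝ → (Fin (d + 1) → ℝ) → (Fin (d + 1) → ℝ))
    (s : ℝ) (x : Fin (d + 1) → ℝ) : Fin (d + 1) → ℝ :=
  Matrix.vecCons 0 (fun i : Fin d => F s x i.succ)

/-- Noise amplitude of the system in which the first component is frozen, seen as a system for
the whole state. -/
def frozenNoise {d m : ℕ} (B : ℝ → (Fin (d + 1) → ℝ) → Matrix (Fin (d + 1)) (Fin m) ℝ)
    (s : ℝ) (x : Fin (d + 1) → ℝ) : Matrix (Fin (d + 1)) (Fin m) ℝ :=
  Matrix.of (Matrix.vecCons (0 : Fin m → ℝ) (fun i : Fin d => B s x i.succ))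

/-- Drift of the system for the components other than the first one, obtained by removing the
first equation and keeping the first component as a parameter `a`. -/
def parameterDrift {d : ℕ} (F : ℝ → (Fin (d + 1) → ℝ) → (Fin (d + 1) → ℝ)) (a : ℝ)
    (s : ℝ) (y : Fin d → ℝ) : Fin d → ℝ :=
  fun i => F s (Matrix.vecCons a y) i.succ

/-- Noise amplitude of the system for the components other than the first one, with the first
component as a parameter `a`. -/
def parameterNoise {d m : ℕ} (B : ℝ → (Fin (d + 1) → ℝ) → Matrix (Fin (d + 1)) (Fin m) ℝ)
    (a : ℝ) (s : ℝ) (y : Fin d → ℝ) : Matrix (Fin d) (Fin m) ℝ :=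
  Matrix.of (fun i l => B s (Matrix.vecCons a y) i.succ l)

/-- The evolution on `[t, t₂]` of the system modified by freezing the first component at time `t`,
given the density `ρt` of the state at time `t`:
* `q s` is the density at time `s` of the state `(x₁(t), x̃(s))` whose first component stays
  what it was at time `t` and whose other components follow the modified system, starting from
  `x(t)` itself (so that `q t = ρt`);
* `r a s` is the density at time `s` of the modified system with parameter `x₁ = a`, equal
  at time `t` to the joint density of the components of `x(t)` other than the first one. -/
def IsFrozenEvolution {d m : ℕ} (F : ℝ → (Fin (d + 1) → ℝ) → (Fin (d + 1) → ℝ))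
    (B : ℝ → (Fin (d + 1) → ℝ) → Matrix (Fin (d + 1)) (Fin m) ℝ)
    (ρt : (Fin (d + 1) → ℝ) → ℝ) (t t₂ : ℝ)
    (q : ℝ → (Fin (d + 1) → ℝ) → ℝ) (r : ℝ → ℝ → (Fin d → ℝ) → ℝ) : Prop :=
  (IsCompactPdf.{u} (frozenDrift F) (frozenNoise B) t t₂ q ∧ q t = ρt) ∧
  ∀ a : ℝ, IsCompactPdf.{u} (parameterDrift F a) (parameterNoise B a) t t₂ (r a) ∧
    r a t = marginalOthers ρt

/-- The entropy at time `s` of the components other than the first one, with the effect of the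
first component excluded: `- E[log r(x₁(t); x̃(s), s)]`, the expectation being over the state
`(x₁(t), x̃(s))` of the modified system. -/
def entropyExcluded {d : ℕ} (q : ℝ → (Fin (d + 1) → ℝ) → ℝ) (r : ℝ → ℝ → (Fin d → ℝ) → ℝ)
    (s : ℝ) : ℝ :=
  - ∫ x : Fin (d + 1) → ℝ, q s x * Real.log (r (x 0) s (Fin.tail x))

/-- `T` is the information flow at time `t` from the first component to the others:
`T = dH_others/dt - dH_excluded/dt`, where both entropies are finite near `t` and both derivatives
exist (the second one from the right, since the modified system starts at time `t`). -/
def IsInformationFlow {d : ℕ} (ρ q : ℝ → (Fin (d + 1) → ℝ) → ℝ) (r : ℝ → ℝ → (Fin d → ℝ) → ℝ)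
    (t T : ℝ) : Prop :=
  (∀ᶠ s in 𝓝 t, Integrable fun y : Fin d → ℝ =>
    marginalOthers (ρ s) y * Real.log (marginalOthers (ρ s) y)) ∧
  (∀ᶠ s in 𝓝[≥] t, Integrable fun x : Fin (d + 1) → ℝ =>
    q s x * Real.log (r (x 0) s (Fin.tail x))) ∧
  ∃ h h' : ℝ, HasDerivAt (entropyOthers ρ) h t ∧
    HasDerivWithinAt (entropyExcluded q r) h' (Ici t) t ∧ T = h - h'

end

/-! ### The generator, its formal adjoint and integration by parts. -/

section Calculus

variable {k m : ℕ}

/-! When rows `2, …, n` of the system ignore `x₁`, the other components form an autonomous system.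
The marginals of `ρ` and of `q`, and the density `r a` for each `a`, then solve one and the same
Fokker-Planck equation, with the same value at time `t`. Uniqueness makes them equal to the right of
`t`, so `-∫ q log r` collapses to the entropy of the marginal of `ρ`: the two entropies coincide for
`s ≥ t`, and their derivatives cancel as soon as the first one exists.

Three facts carry this. Taking expectations in the martingale problem gives the weak equation, for
the full density (`IsCompactPdf.isWeakFokkerPlanck`) and for the marginal
(`IsCompactPdf.isWeakFokkerPlanck_marginalOthers`).

Uniqueness (`IsWeakFokkerPlanck.eqOn`) is an energy estimate for `∫ u²`. It needs no ellipticity,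
because `L(u²) - 2u Lu` is a sum of squares.

The entropy is differentiable although `log` blows up where the density vanishes
(`exists_hasDerivAt_integral_mul_log`): a nonnegative `C²` function of time satisfies `|∂ₜv| ≤ C√v`,
and `√v log v` is bounded. -/

theorem ContDiff.partialD {n : WithTop ℕ∞} {φ : (Fin k → ℝ) → ℝ} (hφ : ContDiff ℝ (n + 1) φ)
    (i : Fin k) : ContDiff ℝ n (partialD i φ) :=
  (hφ.fderiv_right le_rfl).clm_apply contDiff_const

theorem HasCompactSupport.partialD {φ : (Fin k → ℝ) → ℝ} (hφ : HasCompactSupport φ)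
    (i : Fin k) : HasCompactSupport (partialD i φ) :=
  hφ.fderiv_apply ℝ _

/-- A spatial partial derivative is the joint derivative in the direction `(0, eᵢ)`, so regularity
in time and space together is inherited. -/
theorem contDiff_partialD_uncurry {n : WithTop ℕ∞} {f : ℝ × (Fin k → ℝ) → ℝ}
    (hf : ContDiff ℝ (n + 1) f) (i : Fin k) :
    ContDiff ℝ n (fun z : ℝ × (Fin k → ℝ) => partialD i (fun x => f (z.1, x)) z.2) := by
  have h : (fun z : ℝ × (Fin k → ℝ) => partialD i (fun x => f (z.1, x)) z.2) =
      fun z => fderiv ℝ f z (0, Pi.single i 1) := by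
    funext z
    have h1 : HasFDerivAt (fun x : Fin k → ℝ => (z.1, x))
        (ContinuousLinearMap.inr ℝ ℝ (Fin k → ℝ)) z.2 := hasFDerivAt_prodMk_right z.1 z.2
    have h2 : HasFDerivAt f (fderiv ℝ f z) (z.1, z.2) :=
      (hf.differentiable (by simp) z).hasFDerivAt
    have h3 := (h2.comp z.2 h1).fderiv
    simp only [partialD]
    rw [show (fun x => f (z.1, x)) = f ∘ (fun x : Fin k → ℝ => (z.1, x)) from rfl, h3]
    simp
  rw [h]
  exact (hf.fderiv_right le_rfl).clm_apply contDiff_const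

theorem partialD_add {f g : (Fin k → ℝ) → ℝ} {x : Fin k → ℝ} (hf : DifferentiableAt ℝ f x)
    (hg : DifferentiableAt ℝ g x) (i : Fin k) :
    partialD i (fun x => f x + g x) x = partialD i f x + partialD i g x := by
  simp only [partialD]
  rw [fderiv_fun_add hf hg]; simp

theorem partialD_mul {f g : (Fin k → ℝ) → ℝ} {x : Fin k → ℝ} (hf : DifferentiableAt ℝ f x)
    (hg : DifferentiableAt ℝ g x) (i : Fin k) :
    partialD i (fun x => f x * g x) x = f x * partialD i g x + g x * partialD i f x := by
  simp only [partialD]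
  rw [fderiv_fun_mul hf hg]; simp

theorem integral_mul_partialD {f g : (Fin k → ℝ) → ℝ} (hf : ContDiff ℝ 1 f)
    (hg : ContDiff ℝ 1 g) (hc : HasCompactSupport f ∨ HasCompactSupport g) (i : Fin k) :
    ∫ x, f x * partialD i g x = -∫ x, partialD i f x * g x := by
  have hf' : Continuous (partialD i f) := (ContDiff.partialD (n := 0) (by simpa using hf) i).continuous
  have hg' : Continuous (partialD i g) := (ContDiff.partialD (n := 0) (by simpa using hg) i).continuous
  have hsupp : ∀ {f' g' : (Fin k → ℝ) → ℝ}, HasCompactSupport f' ∨ HasCompactSupport g' →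
      HasCompactSupport (fun x => f' x * g' x) := by
    rintro f' g' (h | h)
    · exact h.mul_right
    · exact h.mul_left
  refine integral_mul_fderiv_eq_neg_fderiv_mul_of_integrable ?_ ?_ ?_
    (fun x _ => hf.differentiable (by simp) x) (fun x _ => hg.differentiable (by simp) x)
  · exact (hf'.mul hg.continuous).integrable_of_hasCompactSupport
      (hsupp (hc.imp_left fun h => h.partialD i))
  · exact (hf.continuous.mul hg').integrable_of_hasCompactSupport
      (hsupp (hc.imp_right fun h => h.partialD i))
  · exact (hf.continuous.mul hg.continuous).integrable_of_hasCompactSupport (hsupp hc)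

/-- The diffusion matrix `B Bᵀ`. -/
noncomputable def diffusion (B : ℝ → (Fin k → ℝ) → Matrix (Fin k) (Fin m) ℝ) (i j : Fin k) (s : ℝ)
    (x : Fin k → ℝ) : ℝ := ∑ l, B s x i l * B s x j l

/-- The formal adjoint of the generator. -/
noncomputable def generatorAdjoint (F : ℝ → (Fin k → ℝ) → (Fin k → ℝ))
    (B : ℝ → (Fin k → ℝ) → Matrix (Fin k) (Fin m) ℝ)
    (s : ℝ) (u : (Fin k → ℝ) → ℝ) (x : Fin k → ℝ) : ℝ :=
  -(∑ i, partialD i (fun y => F s y i * u y) x) +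
    (1 / 2) * ∑ i, ∑ j, partialD j (partialD i fun y => diffusion B i j s y * u y) x

variable {F : ℝ → (Fin k → ℝ) → (Fin k → ℝ)} {B : ℝ → (Fin k → ℝ) → Matrix (Fin k) (Fin m) ℝ}

theorem contDiff_diffusion
    (hB : ∀ i l, ContDiff ℝ 2 (fun z : ℝ × (Fin k → ℝ) => B z.1 z.2 i l)) (i j : Fin k) :
    ContDiff ℝ 2 (fun z : ℝ × (Fin k → ℝ) => diffusion B i j z.1 z.2) :=
  ContDiff.sum fun l _ => (hB i l).mul (hB j l)

theorem continuous_generator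
    (hF : ∀ i, ContDiff ℝ 1 (fun z : ℝ × (Fin k → ℝ) => F z.1 z.2 i))
    (hB : ∀ i l, ContDiff ℝ 2 (fun z : ℝ × (Fin k → ℝ) => B z.1 z.2 i l))
    {φ : (Fin k → ℝ) → ℝ} (hφ : ContDiff ℝ 2 φ) :
    Continuous (fun z : ℝ × (Fin k → ℝ) => generator F B z.1 φ z.2) := by
  have h1 : ∀ i, ContDiff ℝ 1 (partialD i φ) := fun i =>
    ContDiff.partialD (by norm_num; exact hφ) i
  have h2 : ∀ i j, Continuous (partialD i (partialD j φ)) := fun i j =>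
    (ContDiff.partialD (n := 0) (by simpa using h1 j) i).continuous
  have hF' := fun i => (hF i).continuous
  have hg := fun i j => (contDiff_diffusion hB i j).continuous
  unfold diffusion at hg
  unfold generator
  refine Continuous.add (continuous_finsetSum _ fun i _ =>
    (hF' i).mul ((h1 i).continuous.comp continuous_snd)) (continuous_const.mul
    (continuous_finsetSum _ fun i _ => continuous_finsetSum _ fun j _ => (hg i j).mul
      ((h2 i j).comp continuous_snd)))

theorem generator_eq_zero_of_notMem_tsupport {φ : (Fin k → ℝ) → ℝ} {x : Fin k → ℝ}
    (hx : x ∉ tsupport φ) (s : ℝ) : generator F B s φ x = 0 := by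
  have h1 : ∀ {ψ : (Fin k → ℝ) → ℝ} (i : Fin k), tsupport (partialD i ψ) ⊆ tsupport ψ :=
    fun i => tsupport_fderiv_apply_subset ℝ _
  have h2 : ∀ i, partialD i φ x = 0 := fun i =>
    image_eq_zero_of_notMem_tsupport fun h => hx (h1 i h)
  have h3 : ∀ i j, partialD i (partialD j φ) x = 0 := fun i j =>
    image_eq_zero_of_notMem_tsupport fun h => hx (h1 j (h1 i h))
  simp [generator, h2, h3]

/-- Locality of the differential operator, which lets a cutoff be ignored wherever it is locally
constant. -/
theorem generator_congr {φ ψ : (Fin k → ℝ) → ℝ} {x : Fin k → ℝ} (h : φ =ᶠ[𝓝 x] ψ) (s : ℝ) :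
    generator F B s φ x = generator F B s ψ x := by
  have h1 : ∀ {f g : (Fin k → ℝ) → ℝ}, f =ᶠ[𝓝 x] g → ∀ i, partialD i f =ᶠ[𝓝 x] partialD i g :=
    fun h i => (h.fderiv (𝕜 := ℝ)).mono fun y hy => by simp only [partialD, hy]
  simp only [generator, fun i => (h1 h i).eq_of_nhds, fun i j => (h1 (h1 h j) i).eq_of_nhds]

theorem continuous_generatorAdjoint
    (hF : ∀ i, ContDiff ℝ 1 (fun z : ℝ × (Fin k → ℝ) => F z.1 z.2 i))
    (hB : ∀ i l, ContDiff ℝ 2 (fun z : ℝ × (Fin k → ℝ) => B z.1 z.2 i l))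
    {φ : (Fin k → ℝ) → ℝ} (hφ : ContDiff ℝ 2 φ) :
    Continuous (fun z : ℝ × (Fin k → ℝ) => generatorAdjoint F B z.1 φ z.2) := by
  have h0 : ContDiff ℝ 2 (fun z : ℝ × (Fin k → ℝ) => φ z.2) := hφ.comp contDiff_snd
  have h1 := fun i => (contDiff_partialD_uncurry (n := 0)
    (f := fun z : ℝ × (Fin k → ℝ) => F z.1 z.2 i * φ z.2)
    (by simpa using (hF i).mul (h0.of_le (by norm_num))) i).continuous
  have h2 := fun i j : Fin k => (contDiff_partialD_uncurry (n := 0) (f := fun z : ℝ × (Fin k → ℝ) =>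
      partialD i (fun y => diffusion B i j z.1 y * φ y) z.2)
    (by
      rw [zero_add]
      exact contDiff_partialD_uncurry (n := 1)
        (f := fun z : ℝ × (Fin k → ℝ) => diffusion B i j z.1 z.2 * φ z.2)
        (by norm_num; exact (contDiff_diffusion hB i j).mul h0) i) j).continuous
  unfold generatorAdjoint
  exact (continuous_finsetSum _ fun i _ => h1 i).neg.add (continuous_const.mul
    (continuous_finsetSum _ fun i _ => continuous_finsetSum _ fun j _ => h2 i j))

/-- Integration by parts, once in the drift terms and twice in the diffusion terms. Compact support
of either factor suffices; this leaves room for the constant function `1` in the energy estimate. -/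
theorem integral_generator_mul {s : ℝ}
    (hF : ∀ i, ContDiff ℝ 1 (fun x => F s x i)) (hB : ∀ i l, ContDiff ℝ 2 (fun x => B s x i l))
    {φ u : (Fin k → ℝ) → ℝ} (hφ : ContDiff ℝ 2 φ) (hu : ContDiff ℝ 2 u)
    (hc : HasCompactSupport φ ∨ HasCompactSupport u) :
    ∫ x, generator F B s φ x * u x = ∫ x, φ x * generatorAdjoint F B s u x := by
  have hg : ∀ i j, ContDiff ℝ 2 (diffusion B i j s) := fun i j =>
    ContDiff.sum fun l _ => (hB i l).mul (hB j l)
  have hφ1 : ContDiff ℝ 1 φ := hφ.of_le (by norm_num)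
  have hu1 : ContDiff ℝ 1 u := hu.of_le (by norm_num)
  have hDφ : ∀ i, ContDiff ℝ 1 (partialD i φ) := fun i =>
    ContDiff.partialD (by norm_num; exact hφ) i
  have hDDφ : ∀ i j, Continuous (partialD i (partialD j φ)) := fun i j =>
    (ContDiff.partialD (n := 0) (by simpa using hDφ j) i).continuous
  have hFu : ∀ i, ContDiff ℝ 1 (fun y => F s y i * u y) := fun i => (hF i).mul hu1
  have hgu : ∀ i j, ContDiff ℝ 2 (fun y => diffusion B i j s y * u y) := fun i j => (hg i j).mul hu
  have hDgu : ∀ i j, ContDiff ℝ 1 (partialD i fun y => diffusion B i j s y * u y) := fun i j =>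
    ContDiff.partialD (by norm_num; exact hgu i j) i
  have hDFu : ∀ i, Continuous (partialD i (fun y => F s y i * u y)) := fun i =>
    (ContDiff.partialD (n := 0) (by simpa using hFu i) i).continuous
  have hDDgu : ∀ i j, Continuous (partialD j (partialD i fun y => diffusion B i j s y * u y)) :=
    fun i j => (ContDiff.partialD (n := 0) (by simpa using hDgu i j) j).continuous
  have hint : ∀ {f g : (Fin k → ℝ) → ℝ}, Continuous f → Continuous g →
      (HasCompactSupport f ∨ HasCompactSupport g) → Integrable (fun x => f x * g x) := by
    rintro f g hf hg (h | h)
    · exact (hf.mul hg).integrable_of_hasCompactSupport h.mul_right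
    · exact (hf.mul hg).integrable_of_hasCompactSupport h.mul_left
  have e1 : ∀ i, ∫ x, (F s x i * u x) * partialD i φ x =
      -∫ x, φ x * partialD i (fun y => F s y i * u y) x := fun i => by
    rw [integral_mul_partialD (hFu i) hφ1 (hc.symm.imp_left fun h => h.mul_left)]
    simp only [mul_comm]
  have e2 : ∀ i j, ∫ x, (diffusion B i j s x * u x) * partialD i (partialD j φ) x =
      ∫ x, φ x * partialD j (partialD i fun y => diffusion B i j s y * u y) x := fun i j => by
    rw [integral_mul_partialD ((hgu i j).of_le (by norm_num)) (hDφ j)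
      (hc.symm.imp (fun h => h.mul_left) fun h => h.partialD j), integral_mul_partialD (hDgu i j) hφ1
      (hc.symm.imp_left fun h => HasCompactSupport.partialD h.mul_left i), neg_neg]
    simp only [mul_comm]
  have i1 : ∀ i, Integrable (fun x => (F s x i * u x) * partialD i φ x) := fun i =>
    hint (hFu i).continuous (hDφ i).continuous
      (hc.symm.imp (fun h => h.mul_left) fun h => h.partialD i)
  have i2 : ∀ i j, Integrable
      (fun x => (diffusion B i j s x * u x) * partialD i (partialD j φ) x) := fun i j =>
    hint (hgu i j).continuous (hDDφ i j)
      (hc.symm.imp (fun h => h.mul_left) fun h => (h.partialD j).partialD i)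
  have i3 : ∀ i, Integrable (fun x => φ x * partialD i (fun y => F s y i * u y) x) := fun i =>
    hint hφ.continuous (hDFu i) (hc.imp_right fun h => HasCompactSupport.partialD h.mul_left i)
  have i4 : ∀ i j, Integrable
      (fun x => φ x * partialD j (partialD i fun y => diffusion B i j s y * u y) x) := fun i j =>
    hint hφ.continuous (hDDgu i j)
      (hc.imp_right fun h => (HasCompactSupport.partialD h.mul_left i).partialD j)
  have l : ∀ x, generator F B s φ x * u x = (∑ i, (F s x i * u x) * partialD i φ x) +
      (1 / 2) * ∑ i, ∑ j, (diffusion B i j s x * u x) * partialD i (partialD j φ) x := fun x => by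
    simp only [generator, diffusion, add_mul, Finset.sum_mul, Finset.mul_sum]
    congr 1
    · exact Finset.sum_congr rfl fun i _ => by ring
    · exact Finset.sum_congr rfl fun i _ => Finset.sum_congr rfl fun j _ =>
        Finset.sum_congr rfl fun l _ => by ring
  have r : ∀ x, φ x * generatorAdjoint F B s u x =
      -(∑ i, φ x * partialD i (fun y => F s y i * u y) x) + (1 / 2) * ∑ i, ∑ j,
        φ x * partialD j (partialD i fun y => diffusion B i j s y * u y) x := fun x => by
    simp only [generatorAdjoint, ← Finset.mul_sum]
    ring
  simp only [l, r]
  rw [integral_add (integrable_finsetSum _ fun i _ => i1 i) ((integrable_finsetSum _ fun i _ =>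
      integrable_finsetSum _ fun j _ => i2 i j).const_mul _),
    integral_add (f := fun x => -(∑ i, φ x * partialD i (fun y => F s y i * u y) x))
      (integrable_finsetSum _ fun i _ => i3 i).neg ((integrable_finsetSum _ fun i _ =>
      integrable_finsetSum _ fun j _ => i4 i j).const_mul _),
    integral_neg, integral_const_mul, integral_const_mul,
    integral_finsetSum _ fun i _ => i1 i, integral_finsetSum _ fun i _ => i3 i,
    integral_finsetSum _ fun i _ => integrable_finsetSum _ fun j _ => i2 i j,
    integral_finsetSum _ fun i _ => integrable_finsetSum _ fun j _ => i4 i j]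
  congr 1
  · simp only [e1, Finset.sum_neg_distrib]
  · congr 1
    refine Finset.sum_congr rfl fun i _ => ?_
    rw [integral_finsetSum _ fun j _ => i2 i j, integral_finsetSum _ fun j _ => i4 i j]
    simp only [e2]

/-- The product rule leaves a quadratic form in the gradient with matrix `B Bᵀ`, hence a sum of
squares. Its sign replaces ellipticity in the uniqueness proof. -/
theorem generator_sq {φ : (Fin k → ℝ) → ℝ} (hφ : ContDiff ℝ 2 φ) (s : ℝ) (x : Fin k → ℝ) :
    generator F B s (fun y => φ y * φ y) x =
      2 * (φ x * generator F B s φ x) + ∑ l, (∑ i, B s x i l * partialD i φ x) ^ 2 := by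
  have hd : Differentiable ℝ φ := hφ.differentiable (by norm_num)
  have hDφ : ∀ i, Differentiable ℝ (partialD i φ) := fun i =>
    (ContDiff.partialD (n := 1) (by norm_num; exact hφ) i).differentiable (by simp)
  have h1 : ∀ i, partialD i (fun y => φ y * φ y) =
      fun x => φ x * partialD i φ x + φ x * partialD i φ x :=
    fun i => funext fun x => partialD_mul (hd x) (hd x) i
  have h2 : ∀ i j, partialD i (partialD j fun y => φ y * φ y) x =
      2 * (φ x * partialD i (partialD j φ) x + partialD j φ x * partialD i φ x) := fun i j => by
    rw [h1, partialD_add ((hd x).fun_mul (hDφ j x)) ((hd x).fun_mul (hDφ j x)),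
      partialD_mul (hd x) (hDφ j x)]
    ring
  have h3 : ∑ l, (∑ i, B s x i l * partialD i φ x) ^ 2 =
      ∑ i, ∑ j, (∑ l, B s x i l * B s x j l) * (partialD j φ x * partialD i φ x) := by
    simp only [sq, Fintype.sum_mul_sum]
    simp only [Finset.sum_mul]
    rw [Finset.sum_comm]
    refine Finset.sum_congr rfl fun i _ => ?_
    rw [Finset.sum_comm]
    exact Finset.sum_congr rfl fun j _ => Finset.sum_congr rfl fun l _ => by ring
  have h4 : ∑ i, ∑ j, (∑ l, B s x i l * B s x j l) *
        (2 * (φ x * partialD i (partialD j φ) x + partialD j φ x * partialD i φ x)) =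
      2 * φ x * (∑ i, ∑ j, (∑ l, B s x i l * B s x j l) * partialD i (partialD j φ) x) +
      2 * ∑ i, ∑ j, (∑ l, B s x i l * B s x j l) * (partialD j φ x * partialD i φ x) := by
    simp only [Finset.mul_sum, ← Finset.sum_add_distrib]
    refine Finset.sum_congr rfl fun i _ => Finset.sum_congr rfl fun j _ => ?_
    simp only [Finset.sum_mul, Finset.mul_sum, ← Finset.sum_add_distrib]
    exact Finset.sum_congr rfl fun l _ => by ring
  have h5 : ∑ i, F s x i * (φ x * partialD i φ x + φ x * partialD i φ x) =
      2 * φ x * ∑ i, F s x i * partialD i φ x := by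
    rw [Finset.mul_sum]; exact Finset.sum_congr rfl fun i _ => by ring
  rw [h3]
  simp only [generator, h2, h4]
  simp only [h1, h5]
  ring

end Calculus

/-! ### Differentiation in time, pointwise and under the integral. -/

section TimeDerivative

theorem continuous_of_continuousOn_prod {E : Type*} [TopologicalSpace E] {I : Set ℝ}
    {u : ℝ → E → ℝ} (hu : ContinuousOn (fun z : ℝ × E => u z.1 z.2) (I ×ˢ univ)) {s : ℝ}
    (hs : s ∈ I) : Continuous (u s) :=
  continuousOn_univ.1 (hu.comp (f := fun x => (s, x)) (by fun_prop) fun x _ => ⟨hs, mem_univ _⟩)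

theorem deriv_time_eq_zero {X : Type*} {v : ℝ → X → ℝ} {a b s : ℝ} (hs : s ∈ Ioo a b) {x : X} (hx : ∀ τ ∈ Ioo a b, v τ x = 0) :
    deriv (fun τ => v τ x) s = 0 := by
  have h : (fun τ => v τ x) =ᶠ[𝓝 s] fun _ => 0 := by
    filter_upwards [isOpen_Ioo.mem_nhds hs] with τ hτ using hx τ hτ
  rw [h.deriv_eq, deriv_const]

/-- Uniform bound on a slab for a function that vanishes off a compact set. -/
theorem exists_bound_of_continuousOn {E : Type*} [TopologicalSpace E]
    {v : ℝ → E → ℝ} {I : Set ℝ} {K : Set E} {c d : ℝ} (hI : Icc c d ⊆ I)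
    (hv : ContinuousOn (fun z : ℝ × E => v z.1 z.2) (I ×ˢ univ)) (hK : IsCompact K)
    (h0 : ∀ s ∈ I, ∀ x, x ∉ K → v s x = 0) :
    ∃ C : ℝ, 0 ≤ C ∧ ∀ s ∈ Icc c d, ∀ x, |v s x| ≤ C := by
  obtain ⟨C, hC⟩ := (isCompact_Icc.prod hK).exists_bound_of_continuousOn
    (hv.mono (prod_mono hI (subset_univ K)))
  refine ⟨max C 0, le_max_right _ _, fun s hs x => ?_⟩
  by_cases hx : x ∈ K
  · exact (hC (s, x) ⟨hs, hx⟩).trans (le_max_left _ _)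
  · simp [h0 s (hI hs) x hx]

variable {E : Type*} [NormedAddCommGroup E] [NormedSpace ℝ E] {v : ℝ → E → ℝ} {a b : ℝ}

theorem hasDerivAt_time_of_contDiffOn
    (hv : ContDiffOn ℝ 1 (fun z : ℝ × E => v z.1 z.2) (Ioo a b ×ˢ univ)) {s : ℝ}
    (hs : s ∈ Ioo a b) (x : E) :
    HasDerivAt (fun τ => v τ x) (fderiv ℝ (fun z : ℝ × E => v z.1 z.2) (s, x) (1, 0)) s := by
  have h1 : HasFDerivAt (fun z : ℝ × E => v z.1 z.2)
      (fderiv ℝ (fun z : ℝ × E => v z.1 z.2) (s, x)) (s, x) :=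
    ((hv.contDiffAt ((isOpen_Ioo.prod isOpen_univ).mem_nhds ⟨hs, mem_univ _⟩)).differentiableAt
      (by simp)).hasFDerivAt
  exact h1.comp_hasDerivAt (f := fun τ => (τ, x)) s ((hasDerivAt_id s).prodMk (hasDerivAt_const s x))

theorem contDiffOn_deriv_time {n : WithTop ℕ∞}
    (hv : ContDiffOn ℝ (n + 1) (fun z : ℝ × E => v z.1 z.2) (Ioo a b ×ˢ univ)) :
    ContDiffOn ℝ n (fun z : ℝ × E => deriv (fun τ => v τ z.2) z.1) (Ioo a b ×ˢ univ) := by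
  have h := (hv.fderiv_of_isOpen (isOpen_Ioo.prod isOpen_univ) le_rfl).clm_apply
    (contDiffOn_const (c := ((1 : ℝ), (0 : E))))
  exact h.congr fun z hz => (hasDerivAt_time_of_contDiffOn (hv.of_le (by simp)) hz.1 z.2).deriv

variable [MeasurableSpace E] [BorelSpace E] {μ : Measure E} [IsFiniteMeasureOnCompacts μ]

theorem hasDerivAt_integral_of_contDiffOn {K : Set E} (hK : IsCompact K)
    (hv : ContDiffOn ℝ 1 (fun z : ℝ × E => v z.1 z.2) (Ioo a b ×ˢ univ))
    (h0 : ∀ s ∈ Ioo a b, ∀ x, x ∉ K → v s x = 0) {s : ℝ} (hs : s ∈ Ioo a b) :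
    HasDerivAt (fun τ => ∫ x, v τ x ∂μ) (∫ x, deriv (fun τ => v τ x) s ∂μ) s := by
  -- The time derivative is continuous only on the open slab; on a compact subinterval around `s` it
  -- is bounded, which gives the dominating function.
  obtain ⟨c, hc, hcs⟩ := exists_between hs.1
  obtain ⟨d, hsd, hd⟩ := exists_between hs.2
  have hI : Icc c d ⊆ Ioo a b := Icc_subset_Ioo hc hd
  have hD := (contDiffOn_deriv_time (n := 0) (by simpa using hv)).continuousOn
  have hD0 : ∀ s ∈ Ioo a b, ∀ x, x ∉ K → deriv (fun τ => v τ x) s = 0 := fun s hs x hx =>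
    deriv_time_eq_zero hs fun τ hτ => h0 τ hτ x hx
  obtain ⟨C, hC0, hC⟩ := exists_bound_of_continuousOn (v := fun s x => deriv (fun τ => v τ x) s)
    hI hD hK hD0
  have hint : ∀ {w : ℝ → E → ℝ}, ContinuousOn (fun z : ℝ × E => w z.1 z.2) (Ioo a b ×ˢ univ) →
      (∀ s ∈ Ioo a b, ∀ x, x ∉ K → w s x = 0) → ∀ τ ∈ Ioo a b, Integrable (w τ) μ :=
    fun hw hw0 τ hτ => (continuous_of_continuousOn_prod hw hτ).integrable_of_hasCompactSupport (HasCompactSupport.intro hK (hw0 τ hτ))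
  refine (hasDerivAt_integral_of_dominated_loc_of_deriv_le (bound := K.indicator fun _ => C)
    (F' := fun s x => deriv (fun τ => v τ x) s)
    (Icc_mem_nhds hcs hsd) ?_ (hint hv.continuousOn h0 s hs)
    (hint (w := fun s x => deriv (fun τ => v τ x) s) hD hD0 s hs).aestronglyMeasurable
    ?_ ?_ ?_).2
  · filter_upwards [isOpen_Ioo.mem_nhds hs] with τ hτ using
      (hint hv.continuousOn h0 τ hτ).aestronglyMeasurable
  · refine Eventually.of_forall fun x τ hτ => ?_
    by_cases hx : x ∈ K
    · simpa [hx] using hC τ hτ x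
    · simp [hx, hD0 τ (hI hτ) x hx]
  · exact (integrable_indicator_iff hK.measurableSet).2 (integrableOn_const hK.measure_ne_top)
  · refine Eventually.of_forall fun x τ hτ => ?_
    exact (hasDerivAt_time_of_contDiffOn hv (hI hτ) x).differentiableAt.hasDerivAt

end TimeDerivative

/-! ### Integrating out the first variable. -/

section Marginal

variable {d : ℕ}

theorem contDiff_vecCons {n : WithTop ℕ∞} :
    ContDiff ℝ n (fun z : ℝ × (Fin d → ℝ) => (Matrix.vecCons z.1 z.2 : Fin (d + 1) → ℝ)) := by
  refine contDiff_pi.2 fun i => ?_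
  refine Fin.cases ?_ (fun j => ?_) i
  · simpa using contDiff_fst
  · exact (contDiff_apply ℝ ℝ j).comp contDiff_snd

theorem contDiff_tail {n : WithTop ℕ∞} :
    ContDiff ℝ n (fun x : Fin (d + 1) → ℝ => (Fin.tail x : Fin d → ℝ)) :=
  contDiff_pi.2 fun i => contDiff_apply ℝ ℝ i.succ

theorem measurePreserving_vecCons :
    MeasurePreserving (fun z : ℝ × (Fin d → ℝ) => (Matrix.vecCons z.1 z.2 : Fin (d + 1) → ℝ)) ∧
    MeasurableEmbedding
      (fun z : ℝ × (Fin d → ℝ) => (Matrix.vecCons z.1 z.2 : Fin (d + 1) → ℝ)) := by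
  have h := (volume_preserving_piFinSuccAbove (fun _ : Fin (d + 1) => ℝ) 0).symm
  have e : ⇑(MeasurableEquiv.piFinSuccAbove (fun _ : Fin (d + 1) => ℝ) 0).symm =
      fun z : ℝ × (Fin d → ℝ) => (Matrix.vecCons z.1 z.2 : Fin (d + 1) → ℝ) := by
    funext z
    simp [MeasurableEquiv.piFinSuccAbove, Matrix.vecCons, Fin.consEquiv]
  rw [← e]
  exact ⟨h, MeasurableEquiv.measurableEmbedding _⟩

theorem integral_eq_integral_integral_vecCons {f : (Fin (d + 1) → ℝ) → ℝ} (hf : Integrable f) :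
    ∫ x, f x = ∫ y : Fin d → ℝ, ∫ a : ℝ, f (Matrix.vecCons a y) := by
  obtain ⟨h1, h2⟩ := measurePreserving_vecCons (d := d)
  rw [← h1.integral_comp h2]
  exact integral_prod_symm _ ((h1.integrable_comp_emb h2).2 hf)

theorem marginalOthers_eq_zero {K : Set (Fin (d + 1) → ℝ)} {f : (Fin (d + 1) → ℝ) → ℝ}
    (h : ∀ x, x ∉ K → f x = 0) {y : Fin d → ℝ} (hy : y ∉ Fin.tail '' K) :
    marginalOthers f y = 0 := by
  have : ∀ a : ℝ, f (Matrix.vecCons a y) = 0 := fun a => h _ fun ha => hy ⟨_, ha, by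
    funext i; simp [Fin.tail]⟩
  simp [marginalOthers, this]

theorem continuousOn_marginalOthers {p : ℝ → (Fin (d + 1) → ℝ) → ℝ} {I : Set ℝ}
    {K : Set (Fin (d + 1) → ℝ)} (hK : IsCompact K)
    (hp : ContinuousOn (fun z : ℝ × (Fin (d + 1) → ℝ) => p z.1 z.2) (I ×ˢ univ))
    (h0 : ∀ s ∈ I, ∀ x, x ∉ K → p s x = 0) :
    ContinuousOn (fun z : ℝ × (Fin d → ℝ) => marginalOthers (p z.1) z.2) (I ×ˢ univ) := by
  refine continuousOn_integral_of_compact_support (k := (fun x : Fin (d + 1) → ℝ => x 0) '' K)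
    (hK.image (continuous_apply 0)) ?_ ?_
  · refine hp.comp (f := fun w : (ℝ × (Fin d → ℝ)) × ℝ =>
      (w.1.1, (Matrix.vecCons w.2 w.1.2 : Fin (d + 1) → ℝ))) ?_ fun w hw => ⟨hw.1.1, mem_univ _⟩
    exact (Continuous.prodMk (by fun_prop)
      ((contDiff_vecCons (n := 0)).continuous.comp
        (f := fun w : (ℝ × (Fin d → ℝ)) × ℝ => (w.2, w.1.2)) (by fun_prop))).continuousOn
  · intro z a hz ha
    exact h0 z.1 hz.1 _ fun h => ha ⟨_, h, by simp⟩

/-- The marginal is the value at `0` of the convolution of the constant `1` with the reflected slice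
`a ↦ p s (-a, y)`, so smoothness of convolutions with parameters applies. -/
theorem contDiffOn_marginalOthers {p : ℝ → (Fin (d + 1) → ℝ) → ℝ} {I : Set ℝ} (hI : IsOpen I)
    {K : Set (Fin (d + 1) → ℝ)} (hK : IsCompact K) {n : ℕ∞}
    (hp : ContDiffOn ℝ n (fun z : ℝ × (Fin (d + 1) → ℝ) => p z.1 z.2) (I ×ˢ univ))
    (h0 : ∀ s ∈ I, ∀ x, x ∉ K → p s x = 0) :
    ContDiffOn ℝ n (fun z : ℝ × (Fin d → ℝ) => marginalOthers (p z.1) z.2) (I ×ˢ univ) := by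
  have h := contDiffOn_convolution_right_with_param_comp (n := n) (𝕜 := ℝ) (μ := (volume : Measure ℝ))
    (ContinuousLinearMap.lsmul ℝ ℝ) (v := fun _ : ℝ × (Fin d → ℝ) => (0 : ℝ))
    (s := I ×ˢ (univ : Set (Fin d → ℝ))) contDiffOn_const (f := fun _ => (1 : ℝ))
    (g := fun z a => p z.1 (Matrix.vecCons (-a) z.2))
    (k := (fun x : Fin (d + 1) → ℝ => -x 0) '' K) (hI.prod isOpen_univ)
    (hK.image (by fun_prop))
    (fun z a hz ha => h0 z.1 hz.1 _ fun h => ha ⟨_, h, by simp⟩)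
    (locallyIntegrable_const 1) (by
      refine hp.comp (f := fun w : (ℝ × (Fin d → ℝ)) × ℝ =>
        (w.1.1, (Matrix.vecCons (-w.2) w.1.2 : Fin (d + 1) → ℝ))) ?_
        fun w hw => ⟨hw.1.1, mem_univ _⟩
      exact (ContDiff.prodMk (by fun_prop)
        (contDiff_vecCons.comp (f := fun w : (ℝ × (Fin d → ℝ)) × ℝ => (-w.2, w.1.2))
          (by fun_prop))).contDiffOn)
  simpa [convolution, marginalOthers] using h

end Marginal

/-! ### From the martingale problem to the weak Fokker-Planck equation. -/

section WeakFokkerPlanck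

/-- `u` is a compactly supported solution on `[a, b]`, in the weak sense, of the Fokker-Planck
equation of the system with drift `F` and noise amplitude `B`, which is `C²` inside `(a, b)`. -/
structure IsWeakFokkerPlanck {k m : ℕ} (F : ℝ → (Fin k → ℝ) → (Fin k → ℝ))
    (B : ℝ → (Fin k → ℝ) → Matrix (Fin k) (Fin m) ℝ) (a b : ℝ)
    (u : ℝ → (Fin k → ℝ) → ℝ) : Prop where
  continuousOn : ContinuousOn (fun z : ℝ × (Fin k → ℝ) => u z.1 z.2) (Icc a b ×ˢ univ)
  contDiffOn : ContDiffOn ℝ 2 (fun z : ℝ × (Fin k → ℝ) => u z.1 z.2) (Ioo a b ×ˢ univ)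
  support : ∃ K : Set (Fin k → ℝ), IsCompact K ∧ ∀ s ∈ Icc a b, ∀ x, x ∉ K → u s x = 0
  hasDerivAt : ∀ φ : (Fin k → ℝ) → ℝ, ContDiff ℝ (⊤ : ℕ∞) φ → HasCompactSupport φ →
    ∀ s ∈ Ioo a b, HasDerivAt (fun τ => ∫ x, φ x * u τ x) (∫ x, generator F B s φ x * u s x) s

variable {k m : ℕ} {F : ℝ → (Fin k → ℝ) → (Fin k → ℝ)}
  {B : ℝ → (Fin k → ℝ) → Matrix (Fin k) (Fin m) ℝ} {a b : ℝ}

/-- The martingale problem yields the time-integrated equation. The integrand is continuous in time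
thanks to the common compact support, so the fundamental theorem of calculus differentiates it. -/
theorem IsWeakFokkerPlanck.of_integral_eq
    (hF : ∀ i, ContDiff ℝ 1 (fun z : ℝ × (Fin k → ℝ) => F z.1 z.2 i))
    (hB : ∀ i l, ContDiff ℝ 2 (fun z : ℝ × (Fin k → ℝ) => B z.1 z.2 i l))
    {u : ℝ → (Fin k → ℝ) → ℝ}
    (hc : ContinuousOn (fun z : ℝ × (Fin k → ℝ) => u z.1 z.2) (Icc a b ×ˢ univ))
    (hd : ContDiffOn ℝ 2 (fun z : ℝ × (Fin k → ℝ) => u z.1 z.2) (Ioo a b ×ˢ univ))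
    {K : Set (Fin k → ℝ)} (hK : IsCompact K) (h0 : ∀ s ∈ Icc a b, ∀ x, x ∉ K → u s x = 0)
    (h : ∀ φ : (Fin k → ℝ) → ℝ, ContDiff ℝ (⊤ : ℕ∞) φ → HasCompactSupport φ → ∀ s ∈ Icc a b,
      ∫ x, φ x * u s x = (∫ x, φ x * u a x) + ∫ τ in a..s, ∫ x, generator F B τ φ x * u τ x) :
    IsWeakFokkerPlanck F B a b u := by
  refine ⟨hc, hd, ⟨K, hK, h0⟩, fun φ hφ hφc s hs => ?_⟩
  have hG : ContinuousOn (fun τ => ∫ x, generator F B τ φ x * u τ x) (Icc a b) :=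
    continuousOn_integral_of_compact_support hK
      (((continuous_generator hF hB (hφ.of_le (by norm_cast))).continuousOn).mul hc)
      fun τ x hτ hx => by simp [h0 τ hτ x hx]
  have hm : Icc a b ∈ 𝓝 s := Icc_mem_nhds hs.1 hs.2
  have h1 : HasDerivAt (fun v => ∫ τ in a..v, ∫ x, generator F B τ φ x * u τ x)
      (∫ x, generator F B s φ x * u s x) s := by
    refine intervalIntegral.integral_hasDerivAt_right ?_ ?_ (hG.continuousAt hm)
    · refine (hG.mono ?_).intervalIntegrable
      rw [uIcc_of_le hs.1.le]
      exact Icc_subset_Icc_right hs.2.le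
    · exact (hG.mono Ioo_subset_Icc_self).stronglyMeasurableAtFilter isOpen_Ioo s hs
  refine (h1.const_add (∫ x, φ x * u a x)).congr_of_eventuallyEq ?_
  filter_upwards [hm] with τ hτ using h φ hφ hφc τ hτ

/-- A martingale has constant expectation; Fubini then moves the expectation inside the time
integral, and the laws are expressed through `p`. -/
theorem IsCompactPdf.integral_eq (hab : a ≤ b)
    (hF : ∀ i, ContDiff ℝ 1 (fun z : ℝ × (Fin k → ℝ) => F z.1 z.2 i))
    (hB : ∀ i l, ContDiff ℝ 2 (fun z : ℝ × (Fin k → ℝ) => B z.1 z.2 i l))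
    {p : ℝ → (Fin k → ℝ) → ℝ} (hp : IsCompactPdf.{u} F B a b p)
    {φ : (Fin k → ℝ) → ℝ} (hφ : ContDiff ℝ (⊤ : ℕ∞) φ) (hφc : HasCompactSupport φ)
    {s : ℝ} (hs : s ∈ Icc a b) :
    ∫ x, φ x * p s x = (∫ x, φ x * p a x) + ∫ τ in a..s, ∫ x, generator F B τ φ x * p τ x := by
  obtain ⟨⟨Ω, mΩ, P, hP, X, ⟨hXc, 𝓕, hXm, hmart⟩, hlaw⟩, hpos, -, hsm⟩ := hp
  have hXmeas : ∀ τ ∈ Icc a b, Measurable (X τ) := fun τ hτ => (hXm ⟨τ, hτ⟩).mono (𝓕.le _) le_rfl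
  have hφ2 : ContDiff ℝ 2 φ := hφ.of_le (by norm_cast)
  have hgc := continuous_generator hF hB hφ2
  have hE : ∀ τ ∈ Icc a b, ∀ g : (Fin k → ℝ) → ℝ, Continuous g →
      ∫ o, g (X τ o) ∂P = ∫ x, g x * p τ x := fun τ hτ g hg => by
    have hm : Measurable fun x => ENNReal.ofReal (p τ x) :=
      (continuous_of_continuousOn_prod hsm.continuousOn hτ).measurable.ennreal_ofReal
    rw [← integral_map (hXmeas τ hτ).aemeasurable hg.aestronglyMeasurable, hlaw τ hτ,
      integral_withDensity_eq_integral_toReal_smul hm (by simp)]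
    refine integral_congr_ae (Eventually.of_forall fun x => ?_)
    simp [ENNReal.toReal_ofReal (hpos τ hτ x), mul_comm]
  have hM := hmart φ hφ hφc
  have ha : a ∈ Icc a b := left_mem_Icc.2 hab
  have hconst := hM.setIntegral_eq (i := ⟨a, ha⟩) (j := ⟨s, hs⟩) (Subtype.mk_le_mk.2 hs.1)
    (MeasurableSet.univ)
  obtain ⟨Cφ, hCφ⟩ := hφ.continuous.bounded_above_of_compact_support hφc
  have hiφ : ∀ τ ∈ Icc a b, Integrable (fun o => φ (X τ o)) P := fun τ hτ =>
    Integrable.of_bound (hφ.continuous.measurable.comp (hXmeas τ hτ)).aestronglyMeasurable Cφ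
      (Eventually.of_forall fun o => hCφ _)
  have hiG : Integrable (fun o => ∫ τ in a..s, generator F B τ φ (X τ o)) P := by
    have := (hiφ s hs).sub (hM.integrable ⟨s, hs⟩)
    refine this.congr (Eventually.of_forall fun o => ?_)
    simp
  simp only [Measure.restrict_univ, intervalIntegral.integral_same, sub_zero] at hconst
  rw [integral_sub (hiφ s hs) hiG, hE a ha φ hφ.continuous, hE s hs φ hφ.continuous] at hconst
  have hswap : ∫ o, (∫ τ in a..s, generator F B τ φ (X τ o)) ∂P =
      ∫ τ in a..s, ∫ x, generator F B τ φ x * p τ x := by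
    obtain ⟨C, -, hC⟩ := exists_bound_of_continuousOn (v := fun τ x => generator F B τ φ x)
      (c := a) (d := b) (subset_univ _) hgc.continuousOn hφc.isCompact
      fun τ _ x hx => generator_eq_zero_of_notMem_tsupport hx τ
    -- Continuity and measurability of `X` are known only for times in `[a, b]`. Clamping time to
    -- this interval gives a jointly measurable process on all of `ℝ`, unchanged on `(a, s]`.
    let π : ℝ → ℝ := fun τ => projIcc a b hab τ
    have hπ : Continuous π := continuous_subtype_val.comp continuous_projIcc
    have hπm : ∀ τ, π τ ∈ Icc a b := fun τ => (projIcc a b hab τ).2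
    have hπe : ∀ τ ∈ Ioc a s, π τ = τ := fun τ hτ => by
      simp [π, projIcc_of_mem hab (show τ ∈ Icc a b from ⟨hτ.1.le, hτ.2.trans hs.2⟩)]
    have hmeas : Measurable (Function.uncurry fun τ o => generator F B (π τ) φ (X (π τ) o)) := by
      refine measurable_uncurry_of_continuous_of_measurable (fun o => ?_) fun τ => ?_
      · exact hgc.comp (hπ.prodMk ((hXc o).comp_continuous hπ hπm))
      · exact (hgc.comp (Continuous.prodMk_right (π τ))).measurable.comp (hXmeas _ (hπm τ))
    have hint : Integrable (Function.uncurry fun o τ => generator F B (π τ) φ (X (π τ) o))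
        (P.prod (volume.restrict (Ioc a s))) :=
      Integrable.of_bound (hmeas.comp measurable_swap).aestronglyMeasurable C
        (Eventually.of_forall fun z => hC _ (hπm _) _)
    simp only [intervalIntegral.integral_of_le hs.1]
    calc ∫ o, (∫ τ in Ioc a s, generator F B τ φ (X τ o)) ∂P
        = ∫ o, (∫ τ in Ioc a s, generator F B (π τ) φ (X (π τ) o)) ∂P := by
          refine integral_congr_ae (Eventually.of_forall fun o => ?_)
          exact setIntegral_congr_fun measurableSet_Ioc fun τ hτ => by simp only [hπe τ hτ]
      _ = ∫ τ in Ioc a s, (∫ o, generator F B (π τ) φ (X (π τ) o) ∂P) := integral_integral_swap hint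
      _ = _ := by
          refine setIntegral_congr_fun measurableSet_Ioc fun τ hτ => ?_
          simp only [hπe τ hτ]
          exact hE τ ⟨hτ.1.le, hτ.2.trans hs.2⟩ _ (hgc.comp (Continuous.prodMk_right τ))
  rw [hswap] at hconst
  linarith

theorem IsCompactPdf.isWeakFokkerPlanck (hab : a ≤ b)
    (hF : ∀ i, ContDiff ℝ 1 (fun z : ℝ × (Fin k → ℝ) => F z.1 z.2 i))
    (hB : ∀ i l, ContDiff ℝ 2 (fun z : ℝ × (Fin k → ℝ) => B z.1 z.2 i l))
    {p : ℝ → (Fin k → ℝ) → ℝ} (hp : IsCompactPdf.{u} F B a b p) :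
    IsWeakFokkerPlanck F B a b p := by
  obtain ⟨-, -, ⟨K, hK, h0⟩, hsm⟩ := id hp
  exact .of_integral_eq hF hB hsm.continuousOn
    (hsm.mono (prod_mono Ioo_subset_Icc_self (subset_univ _))) hK h0
    fun φ hφ hφc s hs => hp.integral_eq hab hF hB hφ hφc hs

end WeakFokkerPlanck

/-! ### The equation satisfied by the marginal. -/

section MarginalFokkerPlanck

variable {d m : ℕ} {F : ℝ → (Fin (d + 1) → ℝ) → (Fin (d + 1) → ℝ)}
  {B : ℝ → (Fin (d + 1) → ℝ) → Matrix (Fin (d + 1)) (Fin m) ℝ} {a b : ℝ}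

theorem contDiff_parameterDrift {n : WithTop ℕ∞}
    (hF : ∀ i, ContDiff ℝ n (fun z : ℝ × (Fin (d + 1) → ℝ) => F z.1 z.2 i)) (c : ℝ) (i : Fin d) :
    ContDiff ℝ n (fun z : ℝ × (Fin d → ℝ) => parameterDrift F c z.1 z.2 i) :=
  (hF i.succ).comp (contDiff_fst.prodMk (contDiff_vecCons.comp (contDiff_const.prodMk contDiff_snd)))

theorem contDiff_parameterNoise {n : WithTop ℕ∞}
    (hB : ∀ i l, ContDiff ℝ n (fun z : ℝ × (Fin (d + 1) → ℝ) => B z.1 z.2 i l)) (c : ℝ)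
    (i : Fin d) (l : Fin m) :
    ContDiff ℝ n (fun z : ℝ × (Fin d → ℝ) => parameterNoise B c z.1 z.2 i l) :=
  (hB i.succ l).comp
    (contDiff_fst.prodMk (contDiff_vecCons.comp (contDiff_const.prodMk contDiff_snd)))

theorem partialD_comp_tail {φ : (Fin d → ℝ) → ℝ} {x : Fin (d + 1) → ℝ}
    (hφ : DifferentiableAt ℝ φ (Fin.tail x)) (i : Fin (d + 1)) :
    partialD i (fun x : Fin (d + 1) → ℝ => φ (Fin.tail x)) x =
      fderiv ℝ φ (Fin.tail x) (Fin.tail (Pi.single i 1 : Fin (d + 1) → ℝ)) := by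
  let L : (Fin (d + 1) → ℝ) →L[ℝ] (Fin d → ℝ) :=
    ContinuousLinearMap.pi fun i => ContinuousLinearMap.proj i.succ
  have hL : ∀ x, L x = Fin.tail x := fun x => rfl
  have h := (HasFDerivAt.comp x (hL x ▸ hφ.hasFDerivAt) L.hasFDerivAt).fderiv
  simp only [partialD]
  exact congrArg (fun T : (Fin (d + 1) → ℝ) →L[ℝ] ℝ => T (Pi.single i 1)) h

theorem partialD_zero_comp_tail {φ : (Fin d → ℝ) → ℝ} (hφ : Differentiable ℝ φ) :
    partialD 0 (fun x : Fin (d + 1) → ℝ => φ (Fin.tail x)) = fun _ => 0 := by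
  funext x
  have h : (Fin.tail (Pi.single 0 1 : Fin (d + 1) → ℝ) : Fin d → ℝ) = 0 := by
    funext i; simp [Fin.tail]
  rw [partialD_comp_tail (hφ _), h, map_zero]

theorem partialD_succ_comp_tail {φ : (Fin d → ℝ) → ℝ} (hφ : Differentiable ℝ φ) (i : Fin d) :
    partialD i.succ (fun x : Fin (d + 1) → ℝ => φ (Fin.tail x)) =
      fun x => partialD i φ (Fin.tail x) := by
  funext x
  have h : (Fin.tail (Pi.single i.succ 1 : Fin (d + 1) → ℝ) : Fin d → ℝ) = Pi.single i 1 := by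
    funext j; simp [Fin.tail, Pi.single_apply]
  rw [partialD_comp_tail (hφ _), h, partialD]

/-- Every derivative in direction `0` of such a function vanishes, so row `0` of `F` and `B` drops
out and `x 0` survives only as a parameter. -/
theorem generator_comp_tail {φ : (Fin d → ℝ) → ℝ} (hφ : ContDiff ℝ 2 φ) (s : ℝ)
    (x : Fin (d + 1) → ℝ) :
    generator F B s (fun x : Fin (d + 1) → ℝ => φ (Fin.tail x)) x =
      generator (parameterDrift F (x 0)) (parameterNoise B (x 0)) s φ (Fin.tail x) := by
  have hd : Differentiable ℝ φ := hφ.differentiable (by norm_num)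
  have hD : ∀ i, Differentiable ℝ (partialD i φ) := fun i =>
    (ContDiff.partialD (n := 1) (by norm_num; exact hφ) i).differentiable (by simp)
  have hz : ∀ i : Fin (d + 1), partialD i (fun _ : Fin (d + 1) → ℝ => (0 : ℝ)) = fun _ => 0 :=
    fun i => by funext x; simp [partialD]
  have hx : (Matrix.vecCons (x 0) (Fin.tail x) : Fin (d + 1) → ℝ) = x := Fin.cons_self_tail x
  simp only [generator, Fin.sum_univ_succ, partialD_zero_comp_tail hd, partialD_succ_comp_tail hd,
    hz, partialD_zero_comp_tail (hD _), partialD_succ_comp_tail (hD _), parameterDrift,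
    parameterNoise, hx, Matrix.of_apply, mul_zero, zero_add, Finset.sum_const_zero]

/-- The full equation is tested with `φ(x₂, …, xₙ)`, cut off in `x₁` outside the support of `p`. As
the parameter does not matter, the resulting integrand depends only on the other variables there,
and `x₁` integrates out. -/
theorem IsCompactPdf.isWeakFokkerPlanck_marginalOthers (hab : a ≤ b)
    (hF : ∀ i, ContDiff ℝ 1 (fun z : ℝ × (Fin (d + 1) → ℝ) => F z.1 z.2 i))
    (hB : ∀ i l, ContDiff ℝ 2 (fun z : ℝ × (Fin (d + 1) → ℝ) => B z.1 z.2 i l))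
    (hFind : ∀ c c', parameterDrift F c = parameterDrift F c')
    (hBind : ∀ c c', parameterNoise B c = parameterNoise B c')
    {p : ℝ → (Fin (d + 1) → ℝ) → ℝ} (hp : IsCompactPdf.{u} F B a b p) :
    IsWeakFokkerPlanck (parameterDrift F 0) (parameterNoise B 0) a b
      (fun s => marginalOthers (p s)) := by
  obtain ⟨-, -, ⟨K, hK, h0⟩, hsm⟩ := id hp
  have hsm' := hsm.mono (prod_mono Ioo_subset_Icc_self (subset_univ univ))
  refine .of_integral_eq (contDiff_parameterDrift hF 0) (contDiff_parameterNoise hB 0)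
    (continuousOn_marginalOthers hK hsm.continuousOn h0)
    (contDiffOn_marginalOthers (n := 2) isOpen_Ioo hK hsm' fun s hs => h0 s (Ioo_subset_Icc_self hs))
    (hK.image (contDiff_tail (n := 0)).continuous)
    (fun s hs y hy => marginalOthers_eq_zero (h0 s hs) hy) fun φ hφ hφc s hs => ?_
  have hφ2 : ContDiff ℝ 2 φ := hφ.of_le (by norm_cast)
  -- The strict inequality makes the bump equal to `1` on a neighbourhood of each point of `K`, so
  -- that derivatives agree as well.
  obtain ⟨R, hR0, hR⟩ : ∃ R : ℝ, 0 < R ∧ ∀ x ∈ K, |x 0| < R := by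
    obtain ⟨C, hC⟩ := hK.exists_bound_of_continuousOn
      (f := fun x : Fin (d + 1) → ℝ => x 0) (by fun_prop)
    exact ⟨max C 0 + 1, by positivity, fun x hx =>
      ((hC x hx).trans (le_max_left _ _)).trans_lt (lt_add_one _)⟩
  let χ : ContDiffBump (0 : ℝ) := ⟨R, R + 1, hR0, lt_add_one R⟩
  let ψ : (Fin (d + 1) → ℝ) → ℝ := fun x => χ (x 0) * φ (Fin.tail x)
  have hψ : ContDiff ℝ (⊤ : ℕ∞) ψ :=
    (χ.contDiff.comp (contDiff_apply ℝ ℝ 0)).mul (hφ.comp contDiff_tail)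
  have hψc : HasCompactSupport ψ := by
    refine HasCompactSupport.intro ((χ.hasCompactSupport.isCompact.prod hφc.isCompact).image
      (contDiff_vecCons (n := 0)).continuous) fun x hx => ?_
    by_contra hne
    refine hx ⟨(x 0, Fin.tail x), ⟨?_, ?_⟩, Fin.cons_self_tail x⟩
    · exact subset_tsupport _ (left_ne_zero_of_mul hne)
    · exact subset_tsupport _ (right_ne_zero_of_mul hne)
  have hloc : ∀ x ∈ K, ψ =ᶠ[𝓝 x] fun x => φ (Fin.tail x) := fun x hx => by
    have h1 : ∀ᶠ y : Fin (d + 1) → ℝ in 𝓝 x, |y 0| < R :=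
      (continuous_apply (A := fun _ : Fin (d + 1) => ℝ) 0).abs.continuousAt.eventually_lt
        continuousAt_const (hR x hx)
    filter_upwards [h1] with y hy
    have : χ (y 0) = 1 := χ.one_of_mem_closedBall (by simpa using hy.le)
    simp [ψ, this]
  have hgen : ∀ τ, ∀ x ∈ K, generator F B τ ψ x =
      generator (parameterDrift F 0) (parameterNoise B 0) τ φ (Fin.tail x) := fun τ x hx => by
    rw [generator_congr (hloc x hx), generator_comp_tail hφ2, hFind (x 0) 0, hBind (x 0) 0]
  have key : ∀ τ ∈ Icc a b, ∀ (f : (Fin (d + 1) → ℝ) → ℝ) (g : (Fin d → ℝ) → ℝ), Continuous f →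
      (∀ x ∈ K, f x = g (Fin.tail x)) →
      ∫ x, f x * p τ x = ∫ y, g y * marginalOthers (p τ) y := fun τ hτ f g hf hfg => by
    rw [integral_eq_integral_integral_vecCons]
    · refine integral_congr_ae (Eventually.of_forall fun y => ?_)
      simp only [marginalOthers]
      rw [← integral_const_mul]
      refine integral_congr_ae (Eventually.of_forall fun c => ?_)
      by_cases hx : (Matrix.vecCons c y : Fin (d + 1) → ℝ) ∈ K
      · simp only [hfg _ hx]
        congr 1
      · simp [h0 τ hτ _ hx]
    · exact (hf.mul (continuous_of_continuousOn_prod hsm.continuousOn hτ)).integrable_of_hasCompactSupport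
        (HasCompactSupport.intro hK fun x hx => by simp [h0 τ hτ x hx])
  have hm := hp.integral_eq hab hF hB hψ hψc hs
  have hgc := continuous_generator hF hB (φ := ψ) (hψ.of_le (by norm_cast))
  rw [key s hs ψ φ hψ.continuous fun x hx => (hloc x hx).eq_of_nhds,
    key a (left_mem_Icc.2 hab) ψ φ hψ.continuous fun x hx => (hloc x hx).eq_of_nhds] at hm
  rw [hm]
  congr 1
  refine intervalIntegral.integral_congr fun τ hτ => ?_
  rw [uIcc_of_le hs.1] at hτ
  exact key τ ⟨hτ.1, hτ.2.trans hs.2⟩ _ _ (hgc.comp (Continuous.prodMk_right τ)) (hgen τ)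

end MarginalFokkerPlanck

/-! ### Uniqueness by an energy estimate. -/

section Uniqueness

variable {k m : ℕ} {F : ℝ → (Fin k → ℝ) → (Fin k → ℝ)}
  {B : ℝ → (Fin k → ℝ) → Matrix (Fin k) (Fin m) ℝ} {a b : ℝ}

theorem IsWeakFokkerPlanck.mono {u : ℝ → (Fin k → ℝ) → ℝ} (hu : IsWeakFokkerPlanck F B a b u)
    {a' b' : ℝ} (ha : a ≤ a') (hb : b' ≤ b) : IsWeakFokkerPlanck F B a' b' u := by
  obtain ⟨K, hK, h0⟩ := hu.support
  have hI : Icc a' b' ⊆ Icc a b := Icc_subset_Icc ha hb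
  have hJ : Ioo a' b' ⊆ Ioo a b := Ioo_subset_Ioo ha hb
  exact ⟨hu.continuousOn.mono (prod_mono hI (subset_univ _)),
    hu.contDiffOn.mono (prod_mono hJ (subset_univ _)), ⟨K, hK, fun s hs => h0 s (hI hs)⟩,
    fun φ hφ hφc s hs => hu.hasDerivAt φ hφ hφc s (hJ hs)⟩

theorem IsWeakFokkerPlanck.sub
    (hF : ∀ i, ContDiff ℝ 1 (fun z : ℝ × (Fin k → ℝ) => F z.1 z.2 i))
    (hB : ∀ i l, ContDiff ℝ 2 (fun z : ℝ × (Fin k → ℝ) => B z.1 z.2 i l))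
    {u v : ℝ → (Fin k → ℝ) → ℝ} (hu : IsWeakFokkerPlanck F B a b u)
    (hv : IsWeakFokkerPlanck F B a b v) :
    IsWeakFokkerPlanck F B a b (fun s x => u s x - v s x) := by
  obtain ⟨K, hK, h0⟩ := hu.support
  obtain ⟨K', hK', h0'⟩ := hv.support
  refine ⟨hu.continuousOn.sub hv.continuousOn, hu.contDiffOn.sub hv.contDiffOn,
    ⟨K ∪ K', hK.union hK', fun s hs x hx => ?_⟩, fun φ hφ hφc s hs => ?_⟩
  · simp [h0 s hs x fun h => hx (Or.inl h), h0' s hs x fun h => hx (Or.inr h)]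
  · have hint : ∀ {w : ℝ → (Fin k → ℝ) → ℝ}, IsWeakFokkerPlanck F B a b w → ∀ τ ∈ Icc a b,
        ∀ f : (Fin k → ℝ) → ℝ, Continuous f → Integrable (fun x => f x * w τ x) := by
      intro w hw τ hτ f hf
      obtain ⟨K, hK, h0⟩ := hw.support
      exact (hf.mul (continuous_of_continuousOn_prod
        hw.continuousOn hτ)).integrable_of_hasCompactSupport
        (HasCompactSupport.intro hK fun x hx => by simp [h0 τ hτ x hx])
    have hgc : Continuous (generator F B s φ) :=
      (continuous_generator hF hB (hφ.of_le (by norm_cast))).comp (Continuous.prodMk_right s)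
    have hsI := Ioo_subset_Icc_self hs
    have h := (hu.hasDerivAt φ hφ hφc s hs).sub (hv.hasDerivAt φ hφ hφc s hs)
    rw [← integral_sub (hint hu s hsI _ hgc) (hint hv s hsI _ hgc)] at h
    simp only [mul_sub]
    refine h.congr_of_eventuallyEq ?_
    filter_upwards [Icc_mem_nhds hs.1 hs.2] with τ hτ
    exact integral_sub (hint hu τ hτ _ hφ.continuous) (hint hv τ hτ _ hφ.continuous)

/-- The weak derivative and the derivative under the integral agree against every test function;
after integration by parts the fundamental lemma of the calculus of variations applies. -/
theorem IsWeakFokkerPlanck.deriv_eq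
    (hF : ∀ i, ContDiff ℝ 1 (fun z : ℝ × (Fin k → ℝ) => F z.1 z.2 i))
    (hB : ∀ i l, ContDiff ℝ 2 (fun z : ℝ × (Fin k → ℝ) => B z.1 z.2 i l))
    {u : ℝ → (Fin k → ℝ) → ℝ} (hu : IsWeakFokkerPlanck F B a b u) {s : ℝ} (hs : s ∈ Ioo a b) :
    (fun x => deriv (fun τ => u τ x) s) =ᵐ[volume] generatorAdjoint F B s (u s) := by
  obtain ⟨K, hK, h0⟩ := hu.support
  have h0' : ∀ s ∈ Ioo a b, ∀ x, x ∉ K → u s x = 0 := fun s hs => h0 s (Ioo_subset_Icc_self hs)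
  have hus : ContDiff ℝ 2 (u s) := contDiffOn_univ.1 (hu.contDiffOn.comp
    (f := fun x => (s, x)) (contDiff_prodMk_right s).contDiffOn fun x _ => ⟨hs, mem_univ _⟩)
  have husc : HasCompactSupport (u s) := HasCompactSupport.intro hK (h0' s hs)
  have hu1 : ContDiffOn ℝ 1 (fun z : ℝ × (Fin k → ℝ) => u z.1 z.2) (Ioo a b ×ˢ univ) :=
    hu.contDiffOn.of_le (by norm_num)
  have hDc : Continuous (fun x => deriv (fun τ => u τ x) s) :=
    continuous_of_continuousOn_prod (u := fun s x => deriv (fun τ => u τ x) s)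
      (contDiffOn_deriv_time (n := 0) (by simpa using hu1)).continuousOn hs
  have hAc : Continuous (generatorAdjoint F B s (u s)) :=
    (continuous_generatorAdjoint hF hB hus).comp (Continuous.prodMk_right s)
  have h : ∀ᵐ x, deriv (fun τ => u τ x) s - generatorAdjoint F B s (u s) x = 0 := by
    refine ae_eq_zero_of_integral_contDiff_smul_eq_zero (hDc.sub hAc).locallyIntegrable
      fun φ hφ hφc => ?_
    have h1 : HasDerivAt (fun τ => ∫ x, φ x * u τ x)
        (∫ x, deriv (fun τ => φ x * u τ x) s) s :=
      hasDerivAt_integral_of_contDiffOn (v := fun τ x => φ x * u τ x) hK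
        (((hφ.of_le (by norm_cast)).comp contDiff_snd).contDiffOn.mul hu1)
        (fun s hs x hx => by simp [h0' s hs x hx]) hs
    have h2 := h1.unique (hu.hasDerivAt φ hφ hφc s hs)
    rw [integral_generator_mul (fun i => (hF i).comp (contDiff_prodMk_right s))
      (fun i l => (hB i l).comp (contDiff_prodMk_right s)) (hφ.of_le (by norm_cast)) hus
      (Or.inl hφc)] at h2
    simp only [deriv_const_mul_field] at h2
    simp only [smul_eq_mul, mul_sub]
    rw [integral_sub, h2, sub_self]
    · exact (hφ.continuous.mul hDc).integrable_of_hasCompactSupport hφc.mul_right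
    · exact (hφ.continuous.mul hAc).integrable_of_hasCompactSupport hφc.mul_right
  filter_upwards [h] with x hx using sub_eq_zero.1 hx

/-- With `E = ∫ u²`, one has `E' = 2∫ u Lu ≤ ∫ L(u²) = ∫ u² L*1 ≤ C E`, and Grönwall's argument
gives `E = 0`. -/
theorem IsWeakFokkerPlanck.eq_zero
    (hF : ∀ i, ContDiff ℝ 1 (fun z : ℝ × (Fin k → ℝ) => F z.1 z.2 i))
    (hB : ∀ i l, ContDiff ℝ 2 (fun z : ℝ × (Fin k → ℝ) => B z.1 z.2 i l))
    {u : ℝ → (Fin k → ℝ) → ℝ} (hu : IsWeakFokkerPlanck F B a b u) (hua : ∀ x, u a x = 0)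
    {s : ℝ} (hs : s ∈ Icc a b) : u s = 0 := by
  obtain ⟨K, hK, h0⟩ := hu.support
  have h0' : ∀ s ∈ Ioo a b, ∀ x, x ∉ K → u s x = 0 := fun s hs => h0 s (Ioo_subset_Icc_self hs)
  have hu1 : ContDiffOn ℝ 1 (fun z : ℝ × (Fin k → ℝ) => u z.1 z.2) (Ioo a b ×ˢ univ) :=
    hu.contDiffOn.of_le (by norm_num)
  -- `L*1` contains one derivative of `F` and two of `B Bᵀ`, hence is continuous and bounded on `[a,
  -- b] × K`.
  obtain ⟨C, hC⟩ := (isCompact_Icc (a := a) (b := b)).prod hK |>.exists_bound_of_continuousOn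
    (continuous_generatorAdjoint hF hB (φ := fun _ => 1) contDiff_const).continuousOn
  let E : ℝ → ℝ := fun τ => ∫ x, u τ x * u τ x
  have hEc : ContinuousOn E (Icc a b) :=
    continuousOn_integral_of_compact_support hK (hu.continuousOn.mul hu.continuousOn)
      fun τ x hτ hx => by simp [h0 τ hτ x hx]
  have hE : ∀ τ ∈ Ioo a b, ∃ e, HasDerivAt E e τ ∧ e ≤ C * E τ := fun τ hτ => by
    have hus : ContDiff ℝ 2 (u τ) := contDiffOn_univ.1 (hu.contDiffOn.comp
      (f := fun x => (τ, x)) (contDiff_prodMk_right τ).contDiffOn fun x _ => ⟨hτ, mem_univ _⟩)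
    have husc : HasCompactSupport (u τ) := HasCompactSupport.intro hK (h0' τ hτ)
    have hFτ : ∀ i, ContDiff ℝ 1 (fun x => F τ x i) := fun i =>
      (hF i).comp (contDiff_prodMk_right τ)
    have hBτ : ∀ i l, ContDiff ℝ 2 (fun x => B τ x i l) := fun i l =>
      (hB i l).comp (contDiff_prodMk_right τ)
    refine ⟨_, hasDerivAt_integral_of_contDiffOn (v := fun τ x => u τ x * u τ x) hK
      (hu1.mul hu1) (fun s hs x hx => by simp [h0' s hs x hx]) hτ, ?_⟩
    have hLc : ∀ {φ : (Fin k → ℝ) → ℝ}, ContDiff ℝ 2 φ → Continuous (generator F B τ φ) :=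
      fun hφ => (continuous_generator hF hB hφ).comp (Continuous.prodMk_right τ)
    have hAc : Continuous (generatorAdjoint F B τ (fun _ => 1)) :=
      (continuous_generatorAdjoint hF hB contDiff_const).comp (Continuous.prodMk_right τ)
    calc ∫ x, deriv (fun τ => u τ x * u τ x) τ
        = ∫ x, 2 * (u τ x * deriv (fun τ => u τ x) τ) := by
          refine integral_congr_ae (Eventually.of_forall fun x => ?_)
          have h := (hasDerivAt_time_of_contDiffOn hu1 hτ x).differentiableAt
          simp only
          rw [deriv_fun_mul h h]
          ring
      _ = 2 * ∫ x, u τ x * generatorAdjoint F B τ (u τ) x := by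
          rw [integral_const_mul]
          congr 1
          refine integral_congr_ae ?_
          filter_upwards [hu.deriv_eq hF hB hτ] with x hx
          rw [hx]
      _ = ∫ x, 2 * (u τ x * generator F B τ (u τ) x) := by
          rw [← integral_generator_mul hFτ hBτ hus hus (Or.inl husc), integral_const_mul]
          simp only [mul_comm]
      -- The factor `1` prepares the next integration by parts, against the constant function.
      _ ≤ ∫ x, generator F B τ (fun y => u τ y * u τ y) x * 1 := by
          refine integral_mono ?_ ?_ fun x => ?_
          · exact (continuous_const.mul (hus.continuous.mul
              (hLc hus))).integrable_of_hasCompactSupport husc.mul_right.mul_left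
          · refine ((hLc (hus.mul hus)).mul continuous_const).integrable_of_hasCompactSupport
              (HasCompactSupport.intro husc.isCompact fun x hx => ?_)
            have h := generator_eq_zero_of_notMem_tsupport (F := F) (B := B)
              (φ := fun y => u τ y * u τ y) (fun h => hx (tsupport_mul_subset_left h)) τ
            simp [h]
          · simp only [mul_one, generator_sq hus]
            exact le_add_of_nonneg_right (Finset.sum_nonneg fun l _ => sq_nonneg _)
      _ = ∫ x, (u τ x * u τ x) * generatorAdjoint F B τ (fun _ => 1) x :=
          integral_generator_mul hFτ hBτ (hus.mul hus) contDiff_const (Or.inl husc.mul_right)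
      _ ≤ ∫ x, C * (u τ x * u τ x) := by
          refine integral_mono ?_ ?_ fun x => ?_
          · exact ((hus.continuous.mul hus.continuous).mul hAc).integrable_of_hasCompactSupport
              husc.mul_right.mul_right
          · exact (continuous_const.mul (hus.continuous.mul
              hus.continuous)).integrable_of_hasCompactSupport husc.mul_right.mul_left
          · by_cases hx : x ∈ K
            · have h := (le_abs_self _).trans (hC (τ, x) ⟨Ioo_subset_Icc_self hτ, hx⟩)
              simp only
              nlinarith [mul_self_nonneg (u τ x)]
            · simp [h0' τ hτ x hx]
      _ = C * E τ := integral_const_mul _ _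
  have hexp : ∀ τ, HasDerivAt (fun τ => Real.exp (-(C * τ))) (Real.exp (-(C * τ)) * -C) τ :=
    fun τ => by simpa using (((hasDerivAt_id τ).const_mul C).neg).exp
  have hanti : AntitoneOn (fun τ => E τ * Real.exp (-(C * τ))) (Icc a b) := by
    refine antitoneOn_of_deriv_nonpos (convex_Icc a b) (hEc.mul (by fun_prop)) ?_ ?_
    · rw [interior_Icc]
      intro τ hτ
      obtain ⟨e, he, -⟩ := hE τ hτ
      exact (he.mul (hexp τ)).differentiableAt.differentiableWithinAt
    · rw [interior_Icc]
      intro τ hτ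
      obtain ⟨e, he, hle⟩ := hE τ hτ
      rw [(he.fun_mul (hexp τ)).deriv]
      nlinarith [Real.exp_pos (-(C * τ))]
  have hEa : E a = 0 := by simp [E, hua]
  have hEs : E s ≤ 0 := by
    have h := hanti (left_mem_Icc.2 (hs.1.trans hs.2)) hs hs.1
    simp only [hEa, zero_mul] at h
    exact nonpos_of_mul_nonpos_left h (Real.exp_pos _)
  have hc := continuous_of_continuousOn_prod hu.continuousOn hs
  have hnn : ∀ x, 0 ≤ u s x * u s x := fun x => mul_self_nonneg _
  have hz := (integral_eq_zero_iff_of_nonneg hnn ((hc.mul hc).integrable_of_hasCompactSupport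
    (HasCompactSupport.intro hK fun x hx => by simp [h0 s hs x hx]))).1
    (le_antisymm hEs (integral_nonneg hnn))
  have hz' := (Continuous.ae_eq_iff_eq volume (hc.mul hc) continuous_zero).1 hz
  funext x
  exact mul_self_eq_zero.1 (congrFun hz' x)

/-- Compactly supported solutions of the Fokker-Planck equation are determined by their initial
value. -/
theorem IsWeakFokkerPlanck.eqOn
    (hF : ∀ i, ContDiff ℝ 1 (fun z : ℝ × (Fin k → ℝ) => F z.1 z.2 i))
    (hB : ∀ i l, ContDiff ℝ 2 (fun z : ℝ × (Fin k → ℝ) => B z.1 z.2 i l))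
    {u v : ℝ → (Fin k → ℝ) → ℝ} (hu : IsWeakFokkerPlanck F B a b u)
    (hv : IsWeakFokkerPlanck F B a b v) (h : u a = v a) : EqOn u v (Icc a b) := fun s hs => by
  have := (hu.sub hF hB hv).eq_zero hF hB (fun x => by simp [h]) hs
  funext x
  exact sub_eq_zero.1 (congrFun this x)

end Uniqueness

/-! ### Differentiability of the entropy integral. -/

section Entropy

/-- The mean value inequality applied twice. This loses the factor `1/2` of Taylor's formula, which
is harmless here. -/
theorem le_add_deriv_mul_add_sq {f f' f'' : ℝ → ℝ} {c d M : ℝ}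
    (hf : ∀ x ∈ Icc c d, HasDerivAt f (f' x) x) (hf' : ∀ x ∈ Icc c d, HasDerivAt f' (f'' x) x)
    (hM : ∀ x ∈ Icc c d, |f'' x| ≤ M) {x y : ℝ} (hx : x ∈ Icc c d) (hy : y ∈ Icc c d) :
    f y ≤ f x + f' x * (y - x) + M * (y - x) ^ 2 := by
  have hsub : uIcc x y ⊆ Icc c d := (convex_Icc c d).ordConnected.uIcc_subset hx hy
  have hM0 : 0 ≤ M := (abs_nonneg _).trans (hM x hx)
  have h1 : ∀ z ∈ uIcc x y, ‖f' z - f' x‖ ≤ M * ‖y - x‖ := fun z hz =>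
    ((convex_uIcc x y).norm_image_sub_le_of_norm_hasDerivWithin_le
      (fun w hw => (hf' w (hsub hw)).hasDerivWithinAt) (fun w hw => hM w (hsub hw))
      left_mem_uIcc hz).trans
      (mul_le_mul_of_nonneg_left (abs_sub_left_of_mem_uIcc hz) hM0)
  have h2 := (convex_uIcc x y).norm_image_sub_le_of_norm_hasDerivWithin_le
    (f := fun z => f z - f' x * z)
    (fun w hw => ((hf w (hsub hw)).sub
      (by simpa using (hasDerivAt_id w).const_mul (f' x))).hasDerivWithinAt)
    h1 left_mem_uIcc right_mem_uIcc
  have h3 := (le_abs_self _).trans h2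
  have h4 : M * ‖y - x‖ * ‖y - x‖ = M * (y - x) ^ 2 := by
    rw [mul_assoc, Real.norm_eq_abs, abs_mul_abs_self, sq]
  rw [h4] at h3
  linarith

/-- The derivative of a nonnegative `C²` function is controlled by the square root of the
function. -/
theorem sq_deriv_le_of_nonneg {f f' f'' : ℝ → ℝ} {c d M D δ N : ℝ}
    (hf : ∀ x ∈ Icc c d, HasDerivAt f (f' x) x) (hf' : ∀ x ∈ Icc c d, HasDerivAt f' (f'' x) x)
    (hM : ∀ x ∈ Icc c d, |f'' x| ≤ M) (hD : ∀ x ∈ Icc c d, |f' x| ≤ D)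
    (h0 : ∀ x ∈ Icc c d, 0 ≤ f x) (hN : 0 < N) (hMN : M ≤ N) (hDN : D ≤ 2 * δ * N)
    {x : ℝ} (hx : Icc (x - δ) (x + δ) ⊆ Icc c d) (hδ : 0 < δ) :
    f' x ^ 2 ≤ 4 * N * f x := by
  have hxI : x ∈ Icc c d := hx ⟨by linarith, by linarith⟩
  have hb := (abs_le.1 ((hD x hxI).trans hDN))
  -- The minimiser of `f x + f' x * h + N * h ^ 2`: nonnegativity there is the discriminant
  -- inequality. The condition `D ≤ 2 * δ * N` ensures `|h| ≤ δ`, so `x + h` stays in `[c, d]`.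
  set h : ℝ := -f' x / (2 * N) with hh
  have hhN : h * (2 * N) = -f' x := by rw [hh]; field_simp
  have hy : x + h ∈ Icc c d := by
    apply hx
    constructor
    · nlinarith
    · nlinarith
  have h1 := (h0 _ hy).trans (le_add_deriv_mul_add_sq hf hf' hM hxI hy)
  have h2 : M * (x + h - x) ^ 2 ≤ N * h ^ 2 := by
    rw [add_sub_cancel_left]; exact mul_le_mul_of_nonneg_right hMN (sq_nonneg _)
  rw [add_sub_cancel_left] at h1 h2
  have h3 : 0 ≤ f x + f' x * h + N * h ^ 2 := by linarith
  have h4 : f' x = -(h * (2 * N)) := by linarith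
  rw [h4] at h3 ⊢
  nlinarith

theorem mul_log_eq_sqrt {x : ℝ} (hx : 0 ≤ x) :
    x * Real.log x = 2 * (√x * (√x * Real.log √x)) := by
  have h := Real.mul_self_sqrt hx
  rw [Real.log_sqrt hx]
  linear_combination -Real.log x * h

/-- Since `√x log x = 2 √x log √x`, this is boundedness of the continuous function `y log y` on `[0,
√R]`. -/
theorem exists_bound_sqrt_mul_log (R : ℝ) :
    ∃ L : ℝ, 0 ≤ L ∧ ∀ x, 0 ≤ x → x ≤ R → √x * |Real.log x| ≤ L := by
  obtain ⟨L, hL⟩ := (isCompact_Icc (a := 0) (b := √R)).exists_bound_of_continuousOn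
    Real.continuous_mul_log.continuousOn
  refine ⟨2 * max L 0, by positivity, fun x hx hxR => ?_⟩
  have h := (hL (√x) ⟨Real.sqrt_nonneg _, Real.sqrt_le_sqrt hxR⟩).trans (le_max_left L 0)
  rw [Real.log_sqrt hx, Real.norm_eq_abs, abs_mul, abs_of_nonneg (Real.sqrt_nonneg x), abs_div,
    abs_of_pos (zero_lt_two' ℝ)] at h
  linarith

/-- Covers the zeros of `f`, where the chain rule for `y log y` fails: `√f = O(y - x)` and `√f log
√f → 0`, so `f log f = o(y - x)`. -/
theorem hasDerivAt_mul_log_of_le_sq {f : ℝ → ℝ} {x M : ℝ} (hc : ContinuousAt f x)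
    (h0 : ∀ᶠ y in 𝓝 x, 0 ≤ f y) (hM : ∀ᶠ y in 𝓝 x, f y ≤ M * (y - x) ^ 2) :
    HasDerivAt (fun y => f y * Real.log (f y)) 0 x := by
  have hfx : f x = 0 := le_antisymm (by simpa using hM.self_of_nhds) h0.self_of_nhds
  have h1 : (fun y => √(f y)) =O[𝓝 x] fun y => y - x := by
    refine Asymptotics.IsBigO.of_bound (√(max M 0)) ?_
    filter_upwards [hM] with y hy
    rw [Real.norm_of_nonneg (Real.sqrt_nonneg _), Real.norm_eq_abs, ← Real.sqrt_sq_eq_abs,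
      ← Real.sqrt_mul (le_max_right _ _)]
    exact Real.sqrt_le_sqrt
      (hy.trans (mul_le_mul_of_nonneg_right (le_max_left _ _) (sq_nonneg _)))
  have h2 : (fun y => √(f y) * Real.log √(f y)) =o[𝓝 x] fun _ => (1 : ℝ) := by
    rw [Asymptotics.isLittleO_one_iff]
    have := (Real.continuous_mul_log.continuousAt (x := √(f x))).comp (f := fun y => √(f y))
      (Real.continuous_sqrt.continuousAt.comp hc)
    simpa [ContinuousAt, hfx, Function.comp_def] using this
  have h3 := (h1.mul_isLittleO h2).const_mul_left 2
  rw [hasDerivAt_iff_isLittleO]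
  refine (h3.congr' ?_ (Eventually.of_forall fun y => mul_one _))
  filter_upwards [h0] with y hy
  simp [hfx, mul_log_eq_sqrt hy]

theorem integrable_mul_log {E : Type*} [TopologicalSpace E] [R1Space E]
    [MeasurableSpace E] [BorelSpace E] {μ : Measure E} [IsFiniteMeasureOnCompacts μ]
    {f : E → ℝ} (hf : Continuous f) {K : Set E} (hK : IsCompact K)
    (h0 : ∀ x, x ∉ K → f x = 0) : Integrable (fun x => f x * Real.log (f x)) μ :=
  (Real.continuous_mul_log.comp hf).integrable_of_hasCompactSupport
    (HasCompactSupport.intro hK fun x hx => by simp [h0 x hx])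

variable {E : Type*} [NormedAddCommGroup E] [NormedSpace ℝ E] [MeasurableSpace E] [BorelSpace E]
  {μ : Measure E} [IsFiniteMeasureOnCompacts μ]

/-- Dominated differentiation with integrand derivative `(log v + 1) ∂ₜv`: the bound `|∂ₜv| ≤ √(4N)
√v` absorbs the logarithm. -/
theorem exists_hasDerivAt_integral_mul_log {v : ℝ → E → ℝ} {a b : ℝ} {K : Set E}
    (hK : IsCompact K)
    (hv : ContDiffOn ℝ 2 (fun z : ℝ × E => v z.1 z.2) (Ioo a b ×ˢ univ))
    (hv0 : ∀ s ∈ Ioo a b, ∀ x, x ∉ K → v s x = 0) (hpos : ∀ s ∈ Ioo a b, ∀ x, 0 ≤ v s x)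
    {s : ℝ} (hs : s ∈ Ioo a b) :
    ∃ h, HasDerivAt (fun τ => ∫ x, v τ x * Real.log (v τ x) ∂μ) h s := by
  let v' : ℝ → E → ℝ := fun s x => deriv (fun τ => v τ x) s
  let v'' : ℝ → E → ℝ := fun s x => deriv (fun τ => v' τ x) s
  have hv1 : ContDiffOn ℝ 1 (fun z : ℝ × E => v z.1 z.2) (Ioo a b ×ˢ univ) :=
    hv.of_le (by norm_num)
  have hv' : ContDiffOn ℝ 1 (fun z : ℝ × E => v' z.1 z.2) (Ioo a b ×ˢ univ) :=
    contDiffOn_deriv_time (by norm_num; exact hv)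
  have hv'' : ContDiffOn ℝ 0 (fun z : ℝ × E => v'' z.1 z.2) (Ioo a b ×ˢ univ) :=
    contDiffOn_deriv_time (by simpa using hv')
  have hv'0 : ∀ s ∈ Ioo a b, ∀ x, x ∉ K → v' s x = 0 := fun s hs x hx =>
    deriv_time_eq_zero hs fun τ hτ => hv0 τ hτ x hx
  have hv''0 : ∀ s ∈ Ioo a b, ∀ x, x ∉ K → v'' s x = 0 := fun s hs x hx =>
    deriv_time_eq_zero hs fun τ hτ => hv'0 τ hτ x hx
  obtain ⟨c, hc, hcs⟩ := exists_between hs.1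
  obtain ⟨d, hsd, hd⟩ := exists_between hs.2
  have hI : Icc c d ⊆ Ioo a b := Icc_subset_Ioo hc hd
  obtain ⟨R, -, hR⟩ := exists_bound_of_continuousOn hI hv.continuousOn hK hv0
  obtain ⟨D, hD0, hD⟩ := exists_bound_of_continuousOn hI hv'.continuousOn hK hv'0
  obtain ⟨M, hM0, hM⟩ := exists_bound_of_continuousOn hI hv''.continuousOn hK hv''0
  have hdv : ∀ x, ∀ τ ∈ Icc c d, HasDerivAt (fun τ => v τ x) (v' τ x) τ := fun x τ hτ =>
    (hasDerivAt_time_of_contDiffOn hv1 (hI hτ) x).differentiableAt.hasDerivAt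
  have hdv' : ∀ x, ∀ τ ∈ Icc c d, HasDerivAt (fun τ => v' τ x) (v'' τ x) τ := fun x τ hτ =>
    (hasDerivAt_time_of_contDiffOn hv' (hI hτ) x).differentiableAt.hasDerivAt
  -- The margin is `2 * δ` because each time within `δ` of `s` needs its own `δ`-neighbourhood
  -- inside `[c, d]`.
  obtain ⟨δ, hδ, hδc, hδd⟩ : ∃ δ : ℝ, 0 < δ ∧ c ≤ s - 2 * δ ∧ s + 2 * δ ≤ d := by
    refine ⟨min (s - c) (d - s) / 2, by have := lt_min (sub_pos.2 hcs) (sub_pos.2 hsd); linarith,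
      ?_, ?_⟩
    · linarith [min_le_left (s - c) (d - s)]
    · linarith [min_le_right (s - c) (d - s)]
  have hJ : Icc (s - δ) (s + δ) ⊆ Icc c d := Icc_subset_Icc (by linarith) (by linarith)
  set N : ℝ := M + D / (2 * δ) + 1 with hN
  have hNpos : 0 < N := by positivity
  have hMN : M ≤ N := by
    have : 0 ≤ D / (2 * δ) := by positivity
    linarith
  have hDN : D ≤ 2 * δ * N := by
    have h1 : 2 * δ * (D / (2 * δ)) = D := by field_simp
    have h2 : 0 ≤ 2 * δ * (M + 1) := by positivity
    rw [hN]; linarith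
  have hsq : ∀ τ ∈ Icc (s - δ) (s + δ), ∀ x, v' τ x ^ 2 ≤ 4 * N * v τ x := fun τ hτ x =>
    sq_deriv_le_of_nonneg (f := fun τ => v τ x) (f' := fun τ => v' τ x) (f'' := fun τ => v'' τ x)
      (hdv x) (hdv' x) (fun σ hσ => hM σ hσ x)
      (fun σ hσ => hD σ hσ x) (fun σ hσ => hpos σ (hI hσ) x) hNpos hMN hDN
      (Icc_subset_Icc (by linarith [hτ.1]) (by linarith [hτ.2])) hδ
  obtain ⟨L, hL0, hL⟩ := exists_bound_sqrt_mul_log R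
  refine ⟨_, (hasDerivAt_integral_of_dominated_loc_of_deriv_le
    (F' := fun τ x => (Real.log (v τ x) + 1) * v' τ x)
    (bound := K.indicator fun _ => √(4 * N) * L + D) (s := Icc (s - δ) (s + δ))
    (Icc_mem_nhds (by linarith) (by linarith)) ?_
    (integrable_mul_log (continuous_of_continuousOn_prod hv.continuousOn hs) hK (hv0 s hs)) ?_ ?_ ?_ ?_).2⟩
  · filter_upwards [isOpen_Ioo.mem_nhds hs] with τ hτ using
      (integrable_mul_log (continuous_of_continuousOn_prod hv.continuousOn hτ) hK (hv0 τ hτ)).aestronglyMeasurable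
  · have h1 := (continuous_of_continuousOn_prod hv.continuousOn hs).measurable.log.add_const 1
    exact (h1.mul (continuous_of_continuousOn_prod hv'.continuousOn hs).measurable).aestronglyMeasurable
  · refine Eventually.of_forall fun x τ hτ => ?_
    have hτ' := hJ hτ
    by_cases hx : x ∈ K
    · have hv0 := hpos τ (hI hτ') x
      have h1 : |v' τ x| ≤ √(4 * N) * √(v τ x) := by
        rw [← Real.sqrt_mul (by positivity)]
        exact Real.abs_le_sqrt (hsq τ hτ x)
      have h2 : |Real.log (v τ x)| * |v' τ x| ≤ √(4 * N) * L :=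
        calc |Real.log (v τ x)| * |v' τ x|
            ≤ |Real.log (v τ x)| * (√(4 * N) * √(v τ x)) := by gcongr
          _ = √(4 * N) * (√(v τ x) * |Real.log (v τ x)|) := by ring
          _ ≤ √(4 * N) * L := by
            gcongr
            exact hL _ hv0 ((le_abs_self _).trans (hR τ hτ' x))
      simp only [hx, indicator_of_mem, Real.norm_eq_abs, add_mul, one_mul]
      refine (abs_add_le _ _).trans (add_le_add ?_ (hD τ hτ' x))
      rwa [abs_mul]
    · simp [hx, hv'0 τ (hI hτ') x hx]
  · exact (integrable_indicator_iff hK.measurableSet).2 (integrableOn_const hK.measure_ne_top)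
  · refine Eventually.of_forall fun x τ hτ => ?_
    have hτ' := hJ hτ
    -- At a zero the square-root bound forces `∂ₜv = 0`, so `v` vanishes to second order in time.
    by_cases hz : v τ x = 0
    · have hz' : v' τ x = 0 := by
        have h := hsq τ hτ x
        rw [hz, mul_zero] at h
        exact pow_eq_zero_iff two_ne_zero |>.1 (le_antisymm h (sq_nonneg _))
      simp only [hz', mul_zero]
      have hmem : Icc c d ∈ 𝓝 τ := Icc_mem_nhds (by linarith [hτ.1]) (by linarith [hτ.2])
      refine hasDerivAt_mul_log_of_le_sq (f := fun τ => v τ x) (M := M)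
        (hdv x τ hτ').continuousAt ?_ ?_
      · filter_upwards [hmem] with σ hσ using hpos σ (hI hσ) x
      · filter_upwards [hmem] with σ hσ
        have h := le_add_deriv_mul_add_sq (hdv x) (hdv' x) (fun σ hσ => hM σ hσ x) hτ' hσ
        simpa [hz, hz'] using h
    · exact (Real.hasDerivAt_mul_log hz).comp τ (hdv x τ hτ')

end Entropy

/-! ### The frozen system and the reduction of its entropy to the marginal. -/

section Frozen

variable {d m : ℕ}

theorem parameterDrift_frozenDrift (F : ℝ → (Fin (d + 1) → ℝ) → (Fin (d + 1) → ℝ)) (c : ℝ) :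
    parameterDrift (frozenDrift F) c = parameterDrift F c := by
  funext s y i
  simp [parameterDrift, frozenDrift]

theorem parameterNoise_frozenNoise
    (B : ℝ → (Fin (d + 1) → ℝ) → Matrix (Fin (d + 1)) (Fin m) ℝ) (c : ℝ) :
    parameterNoise (frozenNoise B) c = parameterNoise B c := by
  funext s y i l
  simp [parameterNoise, frozenNoise]

theorem contDiff_frozenDrift {n : WithTop ℕ∞} {F : ℝ → (Fin (d + 1) → ℝ) → (Fin (d + 1) → ℝ)}
    (hF : ∀ i, ContDiff ℝ n (fun z : ℝ × (Fin (d + 1) → ℝ) => F z.1 z.2 i)) (i : Fin (d + 1)) :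
    ContDiff ℝ n (fun z : ℝ × (Fin (d + 1) → ℝ) => frozenDrift F z.1 z.2 i) := by
  refine Fin.cases ?_ (fun j => ?_) i
  · simpa [frozenDrift] using contDiff_const
  · simpa [frozenDrift] using hF j.succ

theorem contDiff_frozenNoise {n : WithTop ℕ∞}
    {B : ℝ → (Fin (d + 1) → ℝ) → Matrix (Fin (d + 1)) (Fin m) ℝ}
    (hB : ∀ i l, ContDiff ℝ n (fun z : ℝ × (Fin (d + 1) → ℝ) => B z.1 z.2 i l))
    (i : Fin (d + 1)) (l : Fin m) :
    ContDiff ℝ n (fun z : ℝ × (Fin (d + 1) → ℝ) => frozenNoise B z.1 z.2 i l) := by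
  refine Fin.cases ?_ (fun j => ?_) i
  · simpa [frozenNoise] using contDiff_const
  · simpa [frozenNoise] using hB j.succ l

theorem marginalOthers_nonneg {f : (Fin (d + 1) → ℝ) → ℝ} (hf : ∀ x, 0 ≤ f x) (y : Fin d → ℝ) :
    0 ≤ marginalOthers f y :=
  integral_nonneg fun _ => hf _

/-- The expectation of a function of the other components only involves their joint density. -/
theorem integrable_mul_log_marginalOthers {f : (Fin (d + 1) → ℝ) → ℝ} (hf : Continuous f)
    (hc : HasCompactSupport f) (h0 : ∀ x, 0 ≤ f x) :
    Integrable (fun x => f x * Real.log (marginalOthers f (Fin.tail x))) ∧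
      ∫ x, f x * Real.log (marginalOthers f (Fin.tail x)) =
        ∫ y, marginalOthers f y * Real.log (marginalOthers f y) := by
  obtain ⟨h1, h2⟩ := measurePreserving_vecCons (d := d)
  have hz : ∀ x, x ∉ tsupport f → f x = 0 := fun x => image_eq_zero_of_notMem_tsupport
  have hm : Continuous (marginalOthers f) :=
    continuous_of_continuousOn_prod (u := fun _ => marginalOthers f)
      (continuousOn_marginalOthers (p := fun _ => f) (I := univ) hc.isCompact
        (hf.comp continuous_snd).continuousOn fun _ _ => hz) (mem_univ (0 : ℝ))
  have htail : ∀ (a : ℝ) (y : Fin d → ℝ), (Fin.tail (Matrix.vecCons a y) : Fin d → ℝ) = y :=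
    fun a y => by funext i; simp [Fin.tail]
  have hslice : ∀ y : Fin d → ℝ, Integrable fun a : ℝ => f (Matrix.vecCons a y) := fun y =>
    (hf.comp ((contDiff_vecCons (n := 0)).continuous.comp
      (Continuous.prodMk_left y))).integrable_of_hasCompactSupport
      (HasCompactSupport.intro (hc.isCompact.image (continuous_apply 0)) fun a ha =>
        hz _ fun h => ha ⟨_, h, by simp⟩)
  have hint : Integrable (fun x => f x * Real.log (marginalOthers f (Fin.tail x))) := by
    rw [← h1.integrable_comp_emb h2]
    -- The logarithm is unbounded near zeros of the marginal. Integrating the norm over the first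
    -- variable first turns it into `|g log g|` with `g` the marginal, which is continuous with
    -- compact support.
    refine (integrable_prod_iff' ?_).2 ⟨Eventually.of_forall fun y => ?_, ?_⟩
    · have : Measurable fun x : Fin (d + 1) → ℝ => f x * Real.log (marginalOthers f (Fin.tail x)) :=
        hf.measurable.mul (hm.measurable.comp (contDiff_tail (n := 0)).continuous.measurable).log
      exact (this.comp h2.measurable).aestronglyMeasurable
    · simpa only [Function.comp_def, htail] using (hslice y).mul_const _
    · have h := (integrable_mul_log (μ := volume) hm
        (hc.isCompact.image (contDiff_tail (n := 0)).continuous)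
        fun y hy => marginalOthers_eq_zero hz hy).norm
      refine h.congr (Eventually.of_forall fun y => ?_)
      simp only [Function.comp_def, htail, norm_mul, integral_mul_const]
      congr 1
      rw [Real.norm_of_nonneg (marginalOthers_nonneg h0 y)]
      simp only [Real.norm_of_nonneg (h0 _)]
      rfl
  refine ⟨hint, ?_⟩
  rw [integral_eq_integral_integral_vecCons hint]
  refine integral_congr_ae (Eventually.of_forall fun y => ?_)
  simp only [htail, integral_mul_const]
  rfl

end Frozen

/-! ### Coincidence of the two entropies after time `t`. -/

theorem theorem2 {d m : ℕ}
    (F : ℝ → (Fin (d + 1) → ℝ) → (Fin (d + 1) → ℝ))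
    (B : ℝ → (Fin (d + 1) → ℝ) → Matrix (Fin (d + 1)) (Fin m) ℝ)
    (hF : ∀ i, ContDiff ℝ 1 (fun z : ℝ × (Fin (d + 1) → ℝ) => F z.1 z.2 i))
    (hB : ∀ i l, ContDiff ℝ 2 (fun z : ℝ × (Fin (d + 1) → ℝ) => B z.1 z.2 i l))
    (t₀ t₁ : ℝ) (ρ : ℝ → (Fin (d + 1) → ℝ) → ℝ)
    (hρ : IsCompactPdf.{u} F B t₀ t₁ ρ)
    (hFind : ∀ (s a a' : ℝ) (y : Fin d → ℝ) (i : Fin d),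
      F s (Matrix.vecCons a y) i.succ = F s (Matrix.vecCons a' y) i.succ)
    (hBind : ∀ (s a a' : ℝ) (y : Fin d → ℝ) (i : Fin d) (l : Fin m),
      B s (Matrix.vecCons a y) i.succ l = B s (Matrix.vecCons a' y) i.succ l)
    (t : ℝ) (ht : t ∈ Ioo t₀ t₁) (t₂ : ℝ) (ht₂ : t < t₂)
    (q : ℝ → (Fin (d + 1) → ℝ) → ℝ) (r : ℝ → ℝ → (Fin d → ℝ) → ℝ)
    (hqr : IsFrozenEvolution.{u} F B (ρ t) t t₂ q r) :
    IsInformationFlow ρ q r t 0 := by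
  obtain ⟨⟨hq, hqt⟩, hr⟩ := hqr
  have hFi : ∀ c c', parameterDrift F c = parameterDrift F c' := fun c c' => by
    funext s y i; exact hFind s c c' y i
  have hBi : ∀ c c', parameterNoise B c = parameterNoise B c' := fun c c' => by
    funext s y i l; exact hBind s c c' y i l
  have hpF := contDiff_parameterDrift hF 0
  have hpB := contDiff_parameterNoise hB 0
  have hρm := hρ.isWeakFokkerPlanck_marginalOthers (ht.1.trans ht.2).le hF hB hFi hBi
  have hqm : IsWeakFokkerPlanck (parameterDrift F 0) (parameterNoise B 0) t t₂
      fun s => marginalOthers (q s) := by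
    have := hq.isWeakFokkerPlanck_marginalOthers ht₂.le (contDiff_frozenDrift hF)
      (contDiff_frozenNoise hB) (by simpa only [parameterDrift_frozenDrift] using hFi)
      (by simpa only [parameterNoise_frozenNoise] using hBi)
    rwa [parameterDrift_frozenDrift, parameterNoise_frozenNoise] at this
  have hrm : ∀ c, IsWeakFokkerPlanck (parameterDrift F 0) (parameterNoise B 0) t t₂ (r c) :=
    fun c => by
      have h := (hr c).1
      rw [hFi c 0, hBi c 0] at h
      exact h.isWeakFokkerPlanck ht₂.le hpF hpB
  -- Uniqueness removes the dependence on the frozen value `c`, so the logarithm in the excluded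
  -- entropy involves only the other components.
  have hrq : ∀ c, ∀ s ∈ Icc t t₂, r c s = marginalOthers (q s) := fun c s hs =>
    (hrm c).eqOn hpF hpB hqm (by simp only [(hr c).2, hqt]) hs
  have hρq : ∀ s ∈ Icc t (min t₁ t₂), marginalOthers (ρ s) = marginalOthers (q s) := fun s hs =>
    (hρm.mono ht.1.le (min_le_left _ _)).eqOn hpF hpB (hqm.mono le_rfl (min_le_right _ _))
      (by simp only [hqt]) hs
  obtain ⟨-, hq0, ⟨Kq, hKq, hKq0⟩, hqs⟩ := hq
  have hlog : ∀ s ∈ Icc t t₂, Integrable (fun x : Fin (d + 1) → ℝ =>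
      q s x * Real.log (r (x 0) s (Fin.tail x))) ∧
      ∫ x : Fin (d + 1) → ℝ, q s x * Real.log (r (x 0) s (Fin.tail x)) =
        ∫ y, marginalOthers (q s) y * Real.log (marginalOthers (q s) y) := fun s hs => by
    simp only [hrq _ s hs]
    exact integrable_mul_log_marginalOthers
      (continuous_of_continuousOn_prod hqs.continuousOn hs)
      (HasCompactSupport.intro hKq (hKq0 s hs)) (hq0 s hs)
  obtain ⟨K, hK, hK0⟩ := hρm.support
  have hρpos : ∀ s ∈ Ioo t₀ t₁, ∀ y, 0 ≤ marginalOthers (ρ s) y := fun s hs =>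
    marginalOthers_nonneg (hρ.2.1 s (Ioo_subset_Icc_self hs))
  obtain ⟨h, hh⟩ := exists_hasDerivAt_integral_mul_log (μ := volume) hK hρm.contDiffOn
    (fun s hs => hK0 s (Ioo_subset_Icc_self hs)) hρpos ht
  have hmin : t < min t₁ t₂ := lt_min ht.2 ht₂
  have hexcl : ∀ s ∈ Icc t (min t₁ t₂), entropyExcluded q r s = entropyOthers ρ s := fun s hs => by
    rw [entropyExcluded, entropyOthers, (hlog s ⟨hs.1, hs.2.trans (min_le_right _ _)⟩).2, hρq s hs]
  have hderiv : HasDerivAt (entropyOthers ρ) (-h) t := hh.neg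
  refine ⟨?_, ?_, -h, -h, hderiv, ?_, (sub_self _).symm⟩
  · filter_upwards [isOpen_Ioo.mem_nhds ht] with s hs
    have hsI := Ioo_subset_Icc_self hs
    exact integrable_mul_log (continuous_of_continuousOn_prod (u := fun s => marginalOthers (ρ s))
      hρm.continuousOn hsI) hK (hK0 s hsI)
  · filter_upwards [Icc_mem_nhdsGE ht₂] with s hs using (hlog s hs).1
  -- The entropies are known to agree only for `s ≥ t`, which is enough for the right derivative.
  · refine hderiv.hasDerivWithinAt.congr_of_eventuallyEq ?_ (hexcl t ⟨le_rfl, hmin.le⟩)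
    filter_upwards [Icc_mem_nhdsGE hmin] with s hs using hexcl s hs
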